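/- Let $G$ be a second-countable unimodular locally compact (Hausdorff) group with Haar measure $\mu_G$, and let $Q \subseteq G$ be a fixed compact symmetric neighbourhood of the identity. Let $(\pi, \mathcal{H}_\pi)$ be a discrete series representation of $G$: a strongly measurable map $\pi$ from $G$ into the unitary operators of a complex Hilbert space $\mathcal{H}_\pi$ with $\pi(xy) = \sigma(x,y)\pi(x)\pi(y)$ for some $\sigma : G \times G \to \mathbb{T}$, such that $\{0\}$ and $\mathcal{H}_\pi$ are the only closed $\pi$-invariant subspaces, and such that $\int_G |\langle f, \pi(x) f\rangle|^2 \, d\mu_G(x) < \infty$ for some $f \neq 0$. Let $0 \ne g \in \mathcal{B}^2_\pi$; that is, the function $F(x) = \langle g, \pi(x) g\rangle$ lies in $L^\infty_{\mathrm{loc}}(G)$ and its local maximal function $M^L F(x) = \operatorname{ess\,sup}_{z \in Q} |F(xz)|$ lies in $L^2(G)$. Let $\Lambda \subseteq G$ be discrete and suppose that $\pi(\Lambda) g = (\pi(\lambda) g)_{\lambda \in \Lambda}$ is a frame for $\mathcal{H}_\pi$: there are $A, B > 0$ with $A\|f\|^2 \le \sum_{\lambda \in \Lambda} |\langle f, \pi(\lambda)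 g\rangle|^2 \le B \|f\|^2$ for all $f \in \mathcal{H}_\pi$. Let $h_\lambda = S^{-1}\pi(\lambda) g$ be its canonical dual frame, where $S f = \sum_{\lambda \in \Lambda} \langle f, \pi(\lambda) g\rangle \pi(\lambda) g$. A strong Følner sequence is a sequence $(K_n)_{n\in\mathbb{N}}$ of compact subsets of $G$ of positive measure such that, for every non-empty compact $K \subseteq G$, $$\lim_{n\to\infty} \frac{\mu_G(K_n K \,\Delta\, K_n)}{\mu_G(K_n)} = 0 \quad\text{and}\quad \lim_{n\to\infty} \frac{\mu_G(K_n K \cap K_n^c K)}{\mu_G(K_n)} = 0 .$$ Then there are real numbers $M^-$ and $M^+$ such that, for every strong Følner sequence $(K_n)_{n \in \mathbb{N}}$ in $G$, the set $\Lambda \cap xK_n$ is finite and non-empty for all $x \in G$ once $n$ is large enough, both of the following limits exist, and $$\lim_{n \to \infty} \inf_{x \in G} \frac{1}{\#(\Lambda \cap xK_n)} \sum_{\lambda \in \Lambda \cap xK_n} \langle \pi(\lambda) g, h_\lambda\rangle = M^-, \qquad \lim_{n \to \infty} \sup_{x \in G} \frac{1}{\#(\Lambda \cap xK_n)} \sum_{\lambda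 \in \Lambda \cap xK_n} \langle \pi(\lambda) g, h_\lambda\rangle = M^+ .$$ That is, the lower and upper frame measures of $\pi(\Lambda) g$ do not depend on the choice of strong Følner sequence. -/

import Mathlib

open MeasureTheory Filter Topology
open scoped Pointwise ENNReal symmDiff

namespace CoherentFrame

/-- A (right) strong Følner sequence in `G`: non-null compact sets `K n` such that
`μ (K n * L ∆ K n) / μ (K n) → 0` and `μ (K n * L ∩ (K n)ᶜ * L) / μ (K n) → 0` for every
non-empty compact set `L`. -/
structure IsStrongFolner {G : Type*} [Group G] [TopologicalSpace G] [MeasurableSpace G]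
    (μ : Measure G) (K : ℕ → Set G) : Prop where
  isCompact : ∀ n, IsCompact (K n)
  nonnull : ∀ n, 0 < μ (K n)
  folner : ∀ L : Set G, IsCompact L → L.Nonempty →
    Tendsto (fun n => μ ((K n * L) ∆ K n) / μ (K n)) atTop (𝓝 0)
  strong : ∀ L : Set G, IsCompact L → L.Nonempty →
    Tendsto (fun n => μ ((K n * L) ∩ ((K n)ᶜ * L)) / μ (K n)) atTop (𝓝 0)

/-- The left-sided local maximal function
`M^L F (x) = ess sup_{z ∈ Q} |F (x z)|`, with values in `[0, ∞]`. -/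
noncomputable def localMax {G : Type*} [Group G] [MeasurableSpace G]
    (μ : Measure G) (Q : Set G) (F : G → ℂ) (x : G) : ℝ≥0∞ :=
  essSup (fun z => ‖F (x * z)‖ₑ) (μ.restrict Q)

/-- The left-sided Wiener amalgam space `W^L(L^p)`: functions in `L^∞_loc` whose local maximal
function belongs to `L^p`. -/
def wienerAmalgam {G : Type*} [Group G] [TopologicalSpace G] [MeasurableSpace G]
    (μ : Measure G) (Q : Set G) (p : ℝ≥0∞) : Set (G → ℂ) :=
  {F | (∀ L : Set G, IsCompact L → MemLp F ∞ (μ.restrict L)) ∧ MemLp (localMax μ Q F) p μ}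

section Representation

variable {G H : Type*} [NormedAddCommGroup H] [InnerProductSpace ℂ H]

/-- A projective unitary representation: a map into the unitary operators, measurable for the
strong operator topology and multiplicative up to a `𝕋`-valued function. -/
structure IsProjectiveRep [Group G] [MeasurableSpace G] (π : G → H ≃ₗᵢ[ℂ] H) : Prop where
  map_mul : ∃ σ : G → G → Circle, ∀ x y f, π (x * y) f = (σ x y : ℂ) • π x (π y f)
  stronglyMeasurable : ∀ f, StronglyMeasurable fun x => π x f

/-- The only closed invariant subspaces are `{0}` and the whole space. -/
def IsIrreducibleRep (π : G → H ≃ₗᵢ[ℂ] H) : Prop :=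
  ∀ V : Submodule ℂ H, IsClosed (V : Set H) → (∀ x, ∀ v ∈ V, π x v ∈ V) → V = ⊥ ∨ V = ⊤

/-- The coefficient transform `V_g f (x) = ⟨f, π x g⟩`, where `⟨·, ·⟩` is linear in its first
argument (so that the two arguments of Mathlib's `inner` are exchanged). -/
noncomputable def coeff (π : G → H ≃ₗᵢ[ℂ] H) (g f : H) (x : G) : ℂ :=
  inner ℂ (π x g) f

/-- A discrete series representation: an irreducible projective unitary representation with a
non-zero square-integrable vector. -/
structure IsDiscreteSeries [Group G] [MeasurableSpace G] (μ : Measure G)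
    (π : G → H ≃ₗᵢ[ℂ] H) : Prop where
  projective : IsProjectiveRep π
  irreducible : IsIrreducibleRep π
  squareIntegrable : ∃ g : H, g ≠ 0 ∧ MemLp (coeff π g g) 2 μ

/-- The space `B²_π` of all vectors `g` with `V_g g ∈ W^L(L²)`. -/
def B2 [Group G] [TopologicalSpace G] [MeasurableSpace G] (μ : Measure G) (Q : Set G)
    (π : G → H ≃ₗᵢ[ℂ] H) : Set H :=
  {g | coeff π g g ∈ wienerAmalgam μ Q 2}

/-- `(π l g)_{l ∈ Λ}` is a frame:
`A ‖f‖² ≤ ∑_{l ∈ Λ} |⟨f, π l g⟩|² ≤ B ‖f‖²` for all `f`, for some `A, B > 0`. -/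
def IsCoherentFrame (π : G → H ≃ₗᵢ[ℂ] H) (g : H) (Λ : Set G) : Prop :=
  ∃ A B : ℝ, 0 < A ∧ 0 < B ∧ ∀ f : H,
    Summable (fun l : Λ => ‖coeff π g f l‖ ^ 2) ∧
    A * ‖f‖ ^ 2 ≤ ∑' l : Λ, ‖coeff π g f l‖ ^ 2 ∧
    ∑' l : Λ, ‖coeff π g f l‖ ^ 2 ≤ B * ‖f‖ ^ 2

/-- The frame operator `f ↦ ∑_{l ∈ Λ} ⟨f, π l g⟩ π l g`. For a frame the series converges
unconditionally for every `f`. -/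
noncomputable def frameOperator (π : G → H ≃ₗᵢ[ℂ] H) (g : H) (Λ : Set G) (f : H) : H :=
  ∑' l : Λ, coeff π g f l • π l g

/-- The canonical dual frame `h_l = S⁻¹ (π l g)`, where `S` is the frame operator. For a frame
`S` is bijective, and `Function.invFun` is its inverse. -/
noncomputable def canonicalDual (π : G → H ≃ₗᵢ[ℂ] H) (g : H) (Λ : Set G) (l : G) : H :=
  Function.invFun (frameOperator π g Λ) (π l g)

/-- The average `#(Λ ∩ E)⁻¹ ∑_{l ∈ Λ ∩ E} ⟨π l g, h_l⟩`. For a frame each `⟨π l g, h_l⟩` is a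
real number (in `[0, 1]`), so that taking the real part changes nothing; and `Λ ∩ E` is finite
for every relatively compact `E`. -/
noncomputable def frameAverage (π : G → H ≃ₗᵢ[ℂ] H) (g : H) (Λ : Set G) (E : Set G) : ℝ :=
  ((Λ ∩ E).ncard : ℝ)⁻¹ *
    ∑ᶠ l ∈ Λ ∩ E, (inner ℂ (canonicalDual π g Λ l) (π l g)).re

/-- The lower frame measure along `K` exists and equals `M`:
`M = lim_n inf_x #(Λ ∩ x K_n)⁻¹ ∑_{l ∈ Λ ∩ x K_n} ⟨π l g, h_l⟩`. -/
def HasLowerFrameMeasure [Group G] (π : G → H ≃ₗᵢ[ℂ] H) (g : H) (Λ : Set G)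
    (K : ℕ → Set G) (M : ℝ) : Prop :=
  Tendsto (fun n => ⨅ x : G, frameAverage π g Λ (x • K n)) atTop (𝓝 M)

/-- The upper frame measure along `K` exists and equals `M`:
`M = lim_n sup_x #(Λ ∩ x K_n)⁻¹ ∑_{l ∈ Λ ∩ x K_n} ⟨π l g, h_l⟩`. -/
def HasUpperFrameMeasure [Group G] (π : G → H ≃ₗᵢ[ℂ] H) (g : H) (Λ : Set G)
    (K : ℕ → Set G) (M : ℝ) : Prop :=
  Tendsto (fun n => ⨆ x : G, frameAverage π g Λ (x • K n)) atTop (𝓝 M)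

end Representation

end CoherentFrame

/-! Let `c` be the constant with `∫ |⟨f, π(y)g⟩|² dy = c‖f‖²`, and let `E` be compact. The quantity
`∑ ∫ ⟨π(y)g, h_l⟩⟨π(l)g, π(y)g⟩ dy` can be read in two ways. With `l` restricted to `Λ ∩ E` and `y`
ranging over `G`, the orthogonality relation gives `c ∑ ⟨π(l)g, h_l⟩`. With `l` ranging over `Λ` and
`y` restricted to `E`, the reconstruction formula for `π(y)g` gives `‖g‖² μ(E)`. The two differ only
through pairs with exactly one of `l`, `y` in `E`. Since `g ∈ B²`, such pairs count only near the
boundary of `E` (`exists_trace_estimate`), and the strong Følner condition makes that boundary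
negligible, uniformly over translates. So the sum over `Λ ∩ xK_n` is asymptotically `D μ(K_n)` with
`D = ‖g‖²/c` (`eventually_abs_finsum_sub_le`).

Dividing by the number of points, the frame average over `xK_n` is asymptotically `D` over the
density of `Λ` in `xK_n`. Each diagonal coefficient is at most `1`, which keeps these densities away
from `0`. The lower frame measure is therefore `D` over the upper density of `Λ`, and the upper one
is `D` over the lower density.

It remains that the densities do not depend on the Følner sequence. Averaging the number of points
of `E ∩ yK'` over `y` (`lintegral_encard_inter_smul`, where unimodularity enters) compares the
density in `xK_n`, for large `n`, with the extreme densities of any fixed window `K'`. Two sequences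
thus dominate each other's single terms, which forces a common limit (`exists_common_limit`). -/

namespace CoherentFrame

/-! ### Schur's lemma -/

section Schur

variable {G H : Type*} [NormedAddCommGroup H] [InnerProductSpace ℂ H]

/-- Schur's lemma: a bounded self-adjoint operator commuting with an irreducible family of
unitary operators is a real multiple of the identity. -/
theorem exists_eq_smul_of_commute [CompleteSpace H] {π : G → H ≃ₗᵢ[ℂ] H}
    (hπ : IsIrreducibleRep π) {T : H →L[ℂ] H}
    (hT : IsSelfAdjoint T) (hc : ∀ x v, T (π x v) = π x (T v)) :
    ∃ t : ℝ, ∀ v, T v = (t : ℂ) • v := by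
  classical
  rcases subsingleton_or_nontrivial H with h | h
  · exact ⟨0, fun v => Subsingleton.elim _ _⟩
  have key : ∀ a ∈ spectrum ℝ T, ∀ b ∈ spectrum ℝ T, ¬ a < b := by
    intro a ha b hb hab
    obtain ⟨m, ham, hmb⟩ := exists_between hab
    -- Two spectral points are separated by functions with product zero: `φ(T)` and `ψ(T)` are
    -- non-zero but `φ(T)ψ(T) = 0`, so the kernel of `φ(T)` is a proper non-zero closed invariant
    -- subspace.
    let φ : ℝ → ℝ := fun x => max (m - x) 0
    let ψ : ℝ → ℝ := fun x => max (x - m) 0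
    have hφc : Continuous φ := by fun_prop
    have hψc : Continuous ψ := by fun_prop
    have hmul : cfc φ T * cfc ψ T = 0 := by
      rw [← cfc_mul φ ψ T hφc.continuousOn hψc.continuousOn]
      have : (fun x => φ x * ψ x) = fun _ => (0 : ℝ) := by
        funext x
        rcases le_total x m with hx | hx
        · simp [ψ, hx]
        · simp [φ, hx]
      rw [this, cfc_const_zero]
    have hne : ∀ f : ℝ → ℝ, Continuous f → ∀ x ∈ spectrum ℝ T, f x ≠ 0 → cfc f T ≠ 0 := by
      intro f hf x hx hfx h0
      have h1 : cfc f T = cfc (fun _ => (0 : ℝ)) T := by rw [h0, cfc_const_zero]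
      exact hfx ((cfc_eq_cfc_iff_eqOn hT hf.continuousOn continuousOn_const).1 h1 hx)
    have hφ0 : cfc φ T ≠ 0 := hne φ hφc a ha (by simp only [φ]; rw [max_eq_left] <;> linarith)
    have hψ0 : cfc ψ T ≠ 0 := hne ψ hψc b hb (by simp only [ψ]; rw [max_eq_left] <;> linarith)
    have hinv : ∀ x v, cfc φ T (π x v) = π x (cfc φ T v) := by
      intro x v
      let U : H →L[ℂ] H := ((π x).toContinuousLinearEquiv : H →L[ℂ] H)
      have hU : Commute T U := by
        ext v
        exact hc x v
      exact DFunLike.congr_fun (hU.cfc_real φ).eq v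
    rcases hπ (LinearMap.ker (cfc φ T).toLinearMap) (cfc φ T).isClosed_ker
        (fun x v hv => by
          have hv' : cfc φ T v = 0 := hv
          change cfc φ T (π x v) = 0
          rw [hinv, hv', map_zero]) with hV | hV
    · apply hψ0
      ext v
      have h1 : cfc ψ T v ∈ LinearMap.ker (cfc φ T).toLinearMap :=
        DFunLike.congr_fun hmul v
      rw [hV] at h1
      simpa using h1
    · apply hφ0
      ext v
      have h1 : v ∈ LinearMap.ker (cfc φ T).toLinearMap := hV ▸ Submodule.mem_top
      exact h1
  obtain ⟨t, ht⟩ := ContinuousFunctionalCalculus.spectrum_nonempty (R := ℝ) T hT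
  refine ⟨t, fun v => ?_⟩
  have hid : cfc (id : ℝ → ℝ) T = cfc (fun _ : ℝ => t) T := by
    refine cfc_congr fun s hs => ?_
    rcases lt_trichotomy s t with h1 | h1 | h1
    · exact absurd h1 (key s hs t ht)
    · exact h1
    · exact absurd h1 (key t ht s hs)
  rw [cfc_id ℝ T, cfc_const t T] at hid
  rw [hid, Algebra.algebraMap_eq_smul_one]
  simp

end Schur

/-! ### Covariance of the coefficient transform -/

section Algebra

variable {G H : Type*} [Group G] [MeasurableSpace G] [NormedAddCommGroup H]
  [InnerProductSpace ℂ H] {π : G → H ≃ₗᵢ[ℂ] H}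

theorem IsProjectiveRep.exists_symm_apply (hπ : IsProjectiveRep π) (x y : G) :
    ∃ s : Circle, ∀ f, (π x).symm (π y f) = (s : ℂ) • π (x⁻¹ * y) f := by
  obtain ⟨σ, hσ⟩ := hπ.map_mul
  refine ⟨σ x (x⁻¹ * y), fun f => ?_⟩
  have h := hσ x (x⁻¹ * y) f
  rw [mul_inv_cancel_left] at h
  rw [h, map_smul, LinearIsometryEquiv.symm_apply_apply]

/-- The phase of the projective representation enters once plain and once conjugated, so it cancels:
products of this form are genuinely translated, though single coefficients are not. -/
theorem coeff_apply_mul_conj (hπ : IsProjectiveRep π) (g u d : H) (x y : G) :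
    coeff π g (π x u) y * (starRingEnd ℂ) (coeff π g d y) =
      coeff π g u (x⁻¹ * y) * (starRingEnd ℂ) (coeff π g ((π x).symm d) (x⁻¹ * y)) := by
  obtain ⟨s, hs⟩ := hπ.exists_symm_apply x y
  have h1 : coeff π g (π x u) y = inner ℂ ((π x).symm (π y g)) u := by
    rw [coeff, ← (π x).symm.inner_map_map, LinearIsometryEquiv.symm_apply_apply]
  have h2 : coeff π g d y = inner ℂ ((π x).symm (π y g)) ((π x).symm d) := by
    rw [coeff, (π x).symm.inner_map_map]
  have hn : (starRingEnd ℂ) (s : ℂ) * (s : ℂ) = 1 := by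
    rw [← Complex.normSq_eq_conj_mul_self, Circle.normSq_coe, Complex.ofReal_one]
  rw [h1, h2, hs, inner_smul_left, inner_smul_left, map_mul, Complex.conj_conj]
  simp only [coeff]
  linear_combination (inner ℂ (π (x⁻¹ * y) g) u *
    (starRingEnd ℂ) (inner ℂ (π (x⁻¹ * y) g) ((π x).symm d))) * hn

theorem norm_coeff_apply (hπ : IsProjectiveRep π) (g f : H) (x y : G) :
    ‖coeff π g (π x f) y‖ = ‖coeff π g f (x⁻¹ * y)‖ := by
  have h := congrArg norm (coeff_apply_mul_conj hπ g f (π x f) x y)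
  rw [LinearIsometryEquiv.symm_apply_apply] at h
  simp only [norm_mul, RCLike.norm_conj] at h
  exact (mul_self_inj (norm_nonneg _) (norm_nonneg _)).1 h

theorem norm_coeff_apply_swap (hπ : IsProjectiveRep π) (g : H) (x y : G) :
    ‖coeff π g (π x g) y‖ = ‖coeff π g g (y⁻¹ * x)‖ := by
  rw [← norm_coeff_apply hπ, coeff, coeff, norm_inner_symm]

theorem IsProjectiveRep.stronglyMeasurable_coeff (hπ : IsProjectiveRep π) (g f : H) :
    StronglyMeasurable (coeff π g f) :=
  (hπ.stronglyMeasurable g).inner stronglyMeasurable_const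

end Algebra

section Basic

variable {G H : Type*} [NormedAddCommGroup H] [InnerProductSpace ℂ H] {π : G → H ≃ₗᵢ[ℂ] H}

theorem coeff_add (g u v : H) : coeff π g (u + v) = coeff π g u + coeff π g v := by
  funext x; simp [coeff]

theorem coeff_sub (g u v : H) : coeff π g (u - v) = coeff π g u - coeff π g v := by
  funext x; simp [coeff]

theorem coeff_smul (g u : H) (c : ℂ) : coeff π g (c • u) = c • coeff π g u := by
  funext x; simp [coeff]

theorem inner_self_eq_ofReal (f : H) : inner ℂ f f = ((‖f‖ ^ 2 : ℝ) : ℂ) := by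
  rw [inner_self_eq_norm_sq_to_K]; push_cast; rfl

end Basic

section L2

variable {G : Type*} [MeasurableSpace G] {μ : Measure G}

theorem integrable_conj_mul {a b : G → ℂ} (ha : MemLp a 2 μ) (hb : MemLp b 2 μ) :
    Integrable (fun y => (starRingEnd ℂ) (a y) * b y) μ := by
  have ha' : MemLp (fun y => (starRingEnd ℂ) (a y)) 2 μ := ha.star
  exact ha'.integrable_mul hb

theorem integral_conj_mul_self (a : G → ℂ) :
    (∫ y, (starRingEnd ℂ) (a y) * a y ∂μ) = ((∫ y, ‖a y‖ ^ 2 ∂μ : ℝ) : ℂ) := by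
  rw [← integral_complex_ofReal]
  refine integral_congr_ae (ae_of_all _ fun y => ?_)
  simp [Complex.conj_mul']

end L2

/-! ### Orthogonality relations for a square-integrable vector -/

section Orthogonality

variable {G H : Type*} [MeasurableSpace G] [NormedAddCommGroup H] [InnerProductSpace ℂ H] {π : G → H ≃ₗᵢ[ℂ] H} {μ : Measure G}

/-- The graph of the coefficient transform, restricted to its natural domain in `L²`. -/
noncomputable def coeffGraph (π : G → H ≃ₗᵢ[ℂ] H) (g : H) (μ : Measure G) :
    Submodule ℂ (WithLp 2 (H × Lp ℂ 2 μ)) where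
  carrier := {p | p.snd =ᵐ[μ] coeff π g p.fst}
  zero_mem' := by
    have : coeff π g (0 : H) = 0 := by funext x; simp [coeff]
    simp only [Set.mem_ofPred_eq, WithLp.zero_fst, WithLp.zero_snd, this]
    exact Lp.coeFn_zero _ _ _
  add_mem' := by
    intro p q hp hq
    simp only [Set.mem_ofPred_eq, WithLp.add_fst, WithLp.add_snd, coeff_add] at *
    exact (Lp.coeFn_add _ _).trans (hp.add hq)
  smul_mem' := by
    intro c p hp
    simp only [Set.mem_ofPred_eq, WithLp.smul_fst, WithLp.smul_snd, coeff_smul] at *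
    exact (Lp.coeFn_smul _ _).trans (hp.const_smul c)

/-- An `L²`-convergent sequence has an a.e. convergent subsequence, and each coefficient is
continuous in the vector, so the two limits agree a.e. -/
theorem isClosed_coeffGraph (g : H) :
    IsClosed (coeffGraph π g μ : Set (WithLp 2 (H × Lp ℂ 2 μ))) := by
  refine IsSeqClosed.isClosed fun u p hu hup => ?_
  have h1 : Tendsto (fun n => (u n).fst) atTop (𝓝 p.fst) :=
    (WithLp.continuous_fst 2 _ _).continuousAt.tendsto.comp hup
  have h2 : Tendsto (fun n => (u n).snd) atTop (𝓝 p.snd) :=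
    (WithLp.continuous_snd 2 _ _).continuousAt.tendsto.comp hup
  obtain ⟨ns, hns, hae⟩ := (tendstoInMeasure_of_tendsto_Lp h2).exists_seq_tendsto_ae
  have hall : ∀ᵐ x ∂μ, ∀ n, (u n).snd x = coeff π g (u n).fst x := ae_all_iff.2 fun n => hu n
  change p.snd =ᵐ[μ] coeff π g p.fst
  filter_upwards [hae, hall] with x hx hx'
  refine tendsto_nhds_unique hx ?_
  simp only [hx', coeff]
  exact (tendsto_const_nhds.inner (h1.comp hns.tendsto_atTop))

/-- The operator `(1 + V* V)⁻¹`, where `V` is the coefficient transform viewed as a possibly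
unbounded operator into `L²`. -/
theorem exists_coeff_resolvent [CompleteSpace H] (π : G → H ≃ₗᵢ[ℂ] H) (g : H) :
    ∃ T : H →L[ℂ] H, IsSelfAdjoint T ∧ ∀ f, MemLp (coeff π g (T f)) 2 μ ∧
      ∀ d, MemLp (coeff π g d) 2 μ →
        inner ℂ f d = inner ℂ (T f) d +
          ∫ y, (starRingEnd ℂ) (coeff π g (T f) y) * coeff π g d y ∂μ := by
  have : CompleteSpace (coeffGraph π g μ) := (isClosed_coeffGraph g).completeSpace_coe
  -- The coefficient transform is not yet known to map all of `H` into `L²`. `T f` is the first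
  -- component of the projection of `(f, 0)` onto the graph; the residual being orthogonal to the
  -- graph is the weak form of `(1 + V*V) T f = f`.
  let P := (coeffGraph π g μ).starProjection
  let j : H →L[ℂ] WithLp 2 (H × Lp ℂ 2 μ) :=
    ((WithLp.prodContinuousLinearEquiv 2 ℂ H (Lp ℂ 2 μ)).symm : _ →L[ℂ] _) ∘L
      ContinuousLinearMap.inl ℂ H (Lp ℂ 2 μ)
  let T : H →L[ℂ] H := WithLp.fstL 2 ℂ H (Lp ℂ 2 μ) ∘L P ∘L j
  have hj : ∀ p f, inner ℂ (j f) p = inner ℂ f p.fst := by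
    intro p f
    simp [j, WithLp.prod_inner_apply]
  have hj' : ∀ p f, inner ℂ p (j f) = inner ℂ p.fst f := by
    intro p f
    rw [← inner_conj_symm, hj, inner_conj_symm]
  have hT : ∀ f, T f = (P (j f)).fst := fun f => rfl
  have hmem : ∀ f, (P (j f)).snd =ᵐ[μ] coeff π g (T f) := fun f =>
    (coeffGraph π g μ).starProjection_apply_mem (j f)
  refine ⟨T, ContinuousLinearMap.isSelfAdjoint_iff_isSymmetric.2 fun f f' => ?_, fun f =>
    ⟨(memLp_congr_ae (hmem f)).1 (Lp.memLp _), fun d hd => ?_⟩⟩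
  · change inner ℂ (T f) f' = inner ℂ f (T f')
    rw [hT, hT, ← hj, ← hj']
    exact (coeffGraph π g μ).inner_starProjection_left_eq_right _ _
  · let p : WithLp 2 (H × Lp ℂ 2 μ) := WithLp.toLp 2 (d, hd.toLp _)
    have hp : p ∈ coeffGraph π g μ := hd.coeFn_toLp
    have h0 := (coeffGraph π g μ).starProjection_inner_eq_zero (j f) p hp
    rw [inner_sub_left, sub_eq_zero, hj] at h0
    have h1 : inner ℂ (P (j f)) p = inner ℂ (T f) d + inner ℂ (P (j f)).snd (hd.toLp _) := rfl
    change inner ℂ f d = inner ℂ (P (j f)) p at h0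
    rw [h0, h1, L2.inner_def]
    congr 1
    refine integral_congr_ae ?_
    filter_upwards [hmem f, hd.coeFn_toLp] with y hy hy'
    rw [hy, hy', RCLike.inner_apply, mul_comm]

/-- Polarized orthogonality relation. -/
theorem integral_conj_coeff_mul_coeff [CompleteSpace H] {g : H} {c : ℝ}
    (hc : ∀ f, MemLp (coeff π g f) 2 μ ∧ ∫ y, ‖coeff π g f y‖ ^ 2 ∂μ = c * ‖f‖ ^ 2) (u v : H) :
    ∫ y, (starRingEnd ℂ) (coeff π g u y) * coeff π g v y ∂μ = c * inner ℂ u v := by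
  have hq : ∀ f, ∫ y, (starRingEnd ℂ) (coeff π g f y) * coeff π g f y ∂μ = c * inner ℂ f f := by
    intro f
    rw [integral_conj_mul_self, (hc f).2, inner_self_eq_ofReal]
    push_cast; rfl
  have hi : ∀ u v, Integrable (fun y => (starRingEnd ℂ) (coeff π g u y) * coeff π g v y) μ :=
    fun u v => integrable_conj_mul (hc u).1 (hc v).1
  have hexp : ∀ s : ℂ, (starRingEnd ℂ) s * (∫ y, (starRingEnd ℂ) (coeff π g v y) * coeff π g u y ∂μ)
      + s * ∫ y, (starRingEnd ℂ) (coeff π g u y) * coeff π g v y ∂μ =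
      c * ((starRingEnd ℂ) s * inner ℂ v u + s * inner ℂ u v) := by
    intro s
    have h1 := hq (u + s • v)
    have h2 : ∫ y, (starRingEnd ℂ) (coeff π g (u + s • v) y) * coeff π g (u + s • v) y ∂μ =
        (∫ y, (starRingEnd ℂ) (coeff π g u y) * coeff π g u y ∂μ) +
        s * (∫ y, (starRingEnd ℂ) (coeff π g u y) * coeff π g v y ∂μ) +
        (starRingEnd ℂ) s * (∫ y, (starRingEnd ℂ) (coeff π g v y) * coeff π g u y ∂μ) +
        (starRingEnd ℂ) s * s *
          (∫ y, (starRingEnd ℂ) (coeff π g v y) * coeff π g v y ∂μ) := by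
      have i2 : Integrable (fun y => (starRingEnd ℂ) (coeff π g u y) * coeff π g u y +
          s * ((starRingEnd ℂ) (coeff π g u y) * coeff π g v y)) μ :=
        (hi u u).add ((hi u v).const_mul s)
      have i3 : Integrable (fun y => (starRingEnd ℂ) (coeff π g u y) * coeff π g u y +
          s * ((starRingEnd ℂ) (coeff π g u y) * coeff π g v y) +
          (starRingEnd ℂ) s * ((starRingEnd ℂ) (coeff π g v y) * coeff π g u y)) μ :=
        i2.add ((hi v u).const_mul _)
      rw [← integral_const_mul, ← integral_const_mul, ← integral_const_mul,
        ← integral_add (hi u u) ((hi u v).const_mul s), ← integral_add i2 ((hi v u).const_mul _),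
        ← integral_add i3 ((hi v v).const_mul _)]
      refine integral_congr_ae (ae_of_all _ fun y => ?_)
      simp only [coeff_add, coeff_smul, Pi.add_apply, Pi.smul_apply, smul_eq_mul, map_add, map_mul]
      ring
    rw [h2, hq u, hq v] at h1
    simp only [inner_add_left, inner_add_right, inner_smul_left, inner_smul_right] at h1
    linear_combination h1
  -- The values `1` and `i` of `s` separate the two cross terms.
  have e1 := hexp 1
  have e2 := hexp Complex.I
  simp only [map_one, Complex.conj_I] at e1 e2
  linear_combination (1 / 2 : ℂ) * e1 + (-Complex.I / 2) * e2 +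
    (1 / 2 : ℂ) * ((∫ y, (starRingEnd ℂ) (coeff π g u y) * coeff π g v y ∂μ) -
      (∫ y, (starRingEnd ℂ) (coeff π g v y) * coeff π g u y ∂μ) - c * inner ℂ u v +
      c * inner ℂ v u) * Complex.I_sq

variable [Group G] [MeasurableMul G]

theorem memLp_coeff_apply [μ.IsMulLeftInvariant] (hπ : IsProjectiveRep π) {g f : H}
    (hf : MemLp (coeff π g f) 2 μ) (x : G) : MemLp (coeff π g (π x f)) 2 μ := by
  have h := hf.comp_measurePreserving (measurePreserving_mul_left μ x⁻¹)
  exact (memLp_congr_norm (hπ.stronglyMeasurable_coeff _ _).aestronglyMeasurable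
    h.1 (ae_of_all _ fun y => norm_coeff_apply hπ g f x y)).2 h

theorem memLp_coeff_symm_apply [μ.IsMulLeftInvariant] (hπ : IsProjectiveRep π) {g f : H}
    (hf : MemLp (coeff π g f) 2 μ) (x : G) : MemLp (coeff π g ((π x).symm f)) 2 μ := by
  have h := hf.comp_measurePreserving (measurePreserving_mul_left μ x)
  refine (memLp_congr_norm (hπ.stronglyMeasurable_coeff _ _).aestronglyMeasurable
    h.1 (ae_of_all _ fun y => ?_)).2 h
  have h1 := norm_coeff_apply hπ g ((π x).symm f) x (x * y)
  rw [inv_mul_cancel_left, LinearIsometryEquiv.apply_symm_apply] at h1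
  exact h1.symm

/-- A multiple of the coefficient transform of an admissible vector is an isometry into `L²`. -/
theorem exists_integral_norm_coeff_sq_eq [CompleteSpace H] [μ.IsMulLeftInvariant] [NeZero μ]
    (hπ : IsProjectiveRep π)
    (hirr : IsIrreducibleRep π) {g : H} (hg : g ≠ 0) (hgg : MemLp (coeff π g g) 2 μ) :
    ∃ c : ℝ, 0 < c ∧ ∀ f, MemLp (coeff π g f) 2 μ ∧
      ∫ y, ‖coeff π g f y‖ ^ 2 ∂μ = c * ‖f‖ ^ 2 := by
  obtain ⟨T, hTs, hT⟩ := exists_coeff_resolvent (μ := μ) π g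
  -- Injectivity of `1 + V*V` on the domain of `V`: test the equation against the difference `u -
  -- u'` itself.
  have huniq : ∀ u u', MemLp (coeff π g u) 2 μ → MemLp (coeff π g u') 2 μ →
      (∀ d, MemLp (coeff π g d) 2 μ →
        inner ℂ u d + ∫ y, (starRingEnd ℂ) (coeff π g u y) * coeff π g d y ∂μ =
        inner ℂ u' d + ∫ y, (starRingEnd ℂ) (coeff π g u' y) * coeff π g d y ∂μ) → u = u' := by
    intro u u' hu hu' h
    have hw : MemLp (coeff π g (u - u')) 2 μ := by rw [coeff_sub]; exact hu.sub hu'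
    have h1 := h _ hw
    have h2 : inner ℂ (u - u') (u - u') + ∫ y, (starRingEnd ℂ) (coeff π g (u - u') y) *
        coeff π g (u - u') y ∂μ = 0 := by
      have h3 : ∫ y, (starRingEnd ℂ) (coeff π g (u - u') y) * coeff π g (u - u') y ∂μ =
          ∫ y, (starRingEnd ℂ) (coeff π g u y) * coeff π g (u - u') y ∂μ -
          ∫ y, (starRingEnd ℂ) (coeff π g u' y) * coeff π g (u - u') y ∂μ := by
        rw [← integral_sub (integrable_conj_mul hu hw) (integrable_conj_mul hu' hw)]
        refine integral_congr_ae (ae_of_all _ fun y => ?_)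
        simp only
        conv_lhs => rw [coeff_sub, Pi.sub_apply, map_sub, ← Pi.sub_apply, ← coeff_sub]
        ring
      rw [h3, inner_sub_left]
      linear_combination h1
    rw [integral_conj_mul_self, inner_self_eq_ofReal] at h2
    norm_cast at h2
    have h4 : 0 ≤ ∫ y, ‖coeff π g (u - u') y‖ ^ 2 ∂μ := integral_nonneg fun y => by positivity
    have h5 : ‖u - u'‖ ^ 2 = 0 := le_antisymm (by linarith) (by positivity)
    exact sub_eq_zero.1 (norm_eq_zero.1 (pow_eq_zero_iff two_ne_zero |>.1 h5))
  have hcomm : ∀ x v, T (π x v) = π x (T v) := by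
    intro x v
    refine huniq _ _ (hT _).1 (memLp_coeff_apply hπ (hT v).1 x) fun d hd => ?_
    rw [← (hT _).2 d hd]
    have h1 : inner ℂ (π x v) d = inner ℂ v ((π x).symm d) := by
      rw [← (π x).symm.inner_map_map, LinearIsometryEquiv.symm_apply_apply]
    have h2 : inner ℂ (π x (T v)) d = inner ℂ (T v) ((π x).symm d) := by
      rw [← (π x).symm.inner_map_map, LinearIsometryEquiv.symm_apply_apply]
    rw [h1, h2, (hT v).2 _ (memLp_coeff_symm_apply hπ hd x)]
    congr 1
    rw [← integral_mul_left_eq_self (fun y => (starRingEnd ℂ) (coeff π g (T v) y) *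
      coeff π g ((π x).symm d) y) x⁻¹]
    refine integral_congr_ae (ae_of_all _ fun y => ?_)
    have h3 := congrArg (starRingEnd ℂ) (coeff_apply_mul_conj hπ g (T v) d x y)
    simp only [map_mul, Complex.conj_conj] at h3
    exact h3.symm
  -- The resolvent is a scalar, non-zero because `g ≠ 0`. As its range lies in the domain of `V`,
  -- that domain is all of `H`, and `V*V = t⁻¹ - 1`.
  obtain ⟨t, ht⟩ := exists_eq_smul_of_commute hirr hTs hcomm
  have hg2 := (hT g).2 g hgg
  have ht0 : (t : ℂ) ≠ 0 := by
    intro h0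
    rw [ht, h0] at hg2
    have : inner ℂ g g = 0 := by simpa [coeff] using hg2
    exact hg (inner_self_eq_zero.1 this)
  have hmem : ∀ f, MemLp (coeff π g f) 2 μ := by
    intro f
    have h1 := (hT ((t : ℂ)⁻¹ • f)).1
    rwa [ht, smul_inv_smul₀ ht0] at h1
  have heq : ∀ f : H, ‖f‖ ^ 2 = t * (‖f‖ ^ 2 + ∫ y, ‖coeff π g f y‖ ^ 2 ∂μ) := by
    intro f
    have h1 := (hT f).2 f (hmem f)
    rw [ht, inner_smul_left, coeff_smul] at h1
    simp only [Pi.smul_apply, smul_eq_mul, map_mul, Complex.conj_ofReal, mul_assoc] at h1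
    rw [integral_const_mul, integral_conj_mul_self, inner_self_eq_ofReal] at h1
    norm_cast at h1
    linarith
  have ht0' : t ≠ 0 := by exact_mod_cast ht0
  have hcf : ∀ f : H, ∫ y, ‖coeff π g f y‖ ^ 2 ∂μ = (t⁻¹ - 1) * ‖f‖ ^ 2 := by
    intro f
    have h1 : t⁻¹ * ‖f‖ ^ 2 = ‖f‖ ^ 2 + ∫ y, ‖coeff π g f y‖ ^ 2 ∂μ := by
      conv_lhs => rw [heq f]
      field_simp
    linarith
  have hcnn : 0 ≤ t⁻¹ - 1 := by
    have h1 : 0 ≤ (t⁻¹ - 1) * ‖g‖ ^ 2 := by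
      rw [← hcf]; exact integral_nonneg fun y => by positivity
    exact nonneg_of_mul_nonneg_left h1 (by positivity)
  refine ⟨t⁻¹ - 1, lt_of_le_of_ne hcnn fun hc0 => ?_, fun f => ⟨hmem f, hcf f⟩⟩
  have hz : ∀ f, coeff π g f =ᵐ[μ] 0 := by
    intro f
    have h1 := hcf f
    rw [← hc0, zero_mul, integral_eq_zero_iff_of_nonneg (fun y => by positivity)
      ((memLp_two_iff_integrable_sq_norm (hmem f).1).1 (hmem f))] at h1
    filter_upwards [h1] with y hy
    simpa using hy
  -- The null set in `hz` depends on the vector; separability of the range of `x ↦ π x g` removes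
  -- this dependence.
  have hz' : (fun x => π x g) =ᵐ[μ] 0 := by
    refine ae_eq_zero_of_forall_dual_of_isSeparable ℂ (hπ.stronglyMeasurable g).isSeparable_range
      (fun φ => ?_) (ae_of_all _ fun x => Set.mem_range_self x)
    obtain ⟨v, rfl⟩ := (InnerProductSpace.toDual ℂ H).surjective φ
    filter_upwards [hz v] with x hx
    have hx' : inner ℂ (π x g) v = 0 := hx
    simpa using inner_eq_zero_symm.1 hx'
  obtain ⟨x, hx⟩ := hz'.exists
  exact hg (by simpa using hx)

end Orthogonality

/-! ### Frame operator and canonical dual -/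

section Frame

variable {G H : Type*} [NormedAddCommGroup H] [InnerProductSpace ℂ H]
  {π : G → H ≃ₗᵢ[ℂ] H} {g : H} {Λ : Set G}

/-- The analysis operator of a coherent frame, with values in `ℓ²`. -/
theorem IsCoherentFrame.exists_analysis (hF : IsCoherentFrame π g Λ) :
    ∃ C : H →L[ℂ] lp (fun _ : Λ => ℂ) 2, ∀ f l, C f l = coeff π g f l := by
  obtain ⟨A, B, -, hB, h⟩ := hF
  have hmem : ∀ f, Memℓp (fun l : Λ => coeff π g f l) 2 := by
    intro f
    rw [memℓp_gen_iff (by norm_num)]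
    simpa using (h f).1
  let L : H →ₗ[ℂ] lp (fun _ : Λ => ℂ) 2 :=
    { toFun := fun f => ⟨fun l => coeff π g f l, hmem f⟩
      map_add' := fun u v => by ext l; simp [coeff]; rfl
      map_smul' := fun c u => by ext l; simp [coeff] }
  refine ⟨L.mkContinuous (Real.sqrt B) fun f => ?_, fun f l => rfl⟩
  have h1 : ‖L f‖ ^ 2 = ∑' l : Λ, ‖coeff π g f l‖ ^ 2 := by
    have := lp.norm_rpow_eq_tsum (p := 2) (by norm_num) (L f)
    simpa [L] using this
  refine le_of_sq_le_sq ?_ (by positivity)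
  rw [h1, mul_pow, Real.sq_sqrt hB.le]
  exact (h f).2.2

variable [CompleteSpace H]

/-- The frame operator is a self-adjoint invertible bounded operator. -/
theorem IsCoherentFrame.exists_frameOperator (hF : IsCoherentFrame π g Λ) :
    ∃ S R : H →L[ℂ] H, IsSelfAdjoint R ∧ (∀ f, R (S f) = f) ∧ (∀ f, S (R f) = f) ∧
      (∀ f, HasSum (fun l : Λ => coeff π g f l • π l g) (S f)) ∧
      ∀ l, canonicalDual π g Λ l = R (π l g) := by
  obtain ⟨C, hC⟩ := hF.exists_analysis
  obtain ⟨A, B, hA, hB, h⟩ := hF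
  let S : H →L[ℂ] H := ContinuousLinearMap.adjoint C ∘L C
  have hSsa : IsSelfAdjoint S := by
    rw [ContinuousLinearMap.isSelfAdjoint_iff', ContinuousLinearMap.adjoint_comp,
      ContinuousLinearMap.adjoint_adjoint]
  have hin : ∀ f, inner ℂ (S f) f = ((∑' l : Λ, ‖coeff π g f l‖ ^ 2 : ℝ) : ℂ) := by
    intro f
    have h1 : ‖C f‖ ^ 2 = ∑' l : Λ, ‖coeff π g f l‖ ^ 2 := by
      have := lp.norm_rpow_eq_tsum (p := 2) (by norm_num) (C f)
      simpa [hC] using this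
    rw [← h1, ← inner_self_eq_ofReal]
    exact ContinuousLinearMap.adjoint_inner_left C f (C f)
  -- The lower frame bound makes `S` coercive.
  have hunit : IsUnit S := by
    refine S.isUnit_of_forall_le_norm_inner_map (c := ⟨A, hA.le⟩) hA fun f => ?_
    rw [hin, Complex.norm_real, Real.norm_eq_abs]
    refine le_trans ?_ (le_abs_self _)
    rw [mul_comm]
    exact (h f).2.1
  obtain ⟨R, hR1, hR2⟩ : ∃ R : H →L[ℂ] H, S * R = 1 ∧ R * S = 1 :=
    ⟨_, hunit.mul_val_inv, hunit.val_inv_mul⟩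
  have hRS : ∀ f, R (S f) = f := fun f => DFunLike.congr_fun hR2 f
  have hSR : ∀ f, S (R f) = f := fun f => DFunLike.congr_fun hR1 f
  have hsum : ∀ f, HasSum (fun l : Λ => coeff π g f l • π l g) (S f) := by
    classical
    intro f
    have h1 := (ContinuousLinearMap.adjoint C).hasSum (lp.hasSum_single (p := 2) (by norm_num) (C f))
    refine h1.congr_fun fun l => ?_
    refine ext_inner_right ℂ fun v => ?_
    rw [ContinuousLinearMap.adjoint_inner_left, lp.inner_single_left, hC, hC, inner_smul_left]
    simp [coeff, mul_comm]
  refine ⟨S, R, ?_, hRS, hSR, hsum, fun l => ?_⟩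
  · rw [ContinuousLinearMap.isSelfAdjoint_iff_isSymmetric]
    intro u v
    change inner ℂ (R u) v = inner ℂ u (R v)
    have h2 := (ContinuousLinearMap.isSelfAdjoint_iff_isSymmetric.1 hSsa) (R u) (R v)
    change inner ℂ (S (R u)) (R v) = inner ℂ (R u) (S (R v)) at h2
    rw [hSR, hSR] at h2
    exact h2.symm
  · have hfo : frameOperator π g Λ = S := by
      funext f
      exact (hsum f).tsum_eq
    rw [canonicalDual, hfo]
    have hinj : Function.Injective S := Function.LeftInverse.injective hRS
    apply hinj
    rw [hSR, Function.invFun_eq ⟨R (π l g), hSR _⟩]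

/-- The properties of the canonical dual of a coherent frame used below: Bessel bound,
reconstruction formula, and the size of the diagonal coefficients. -/
theorem IsCoherentFrame.canonicalDual_spec (hF : IsCoherentFrame π g Λ) :
    (∃ B : ℝ, 0 ≤ B ∧ ∀ f, Summable (fun l : Λ => ‖inner ℂ (canonicalDual π g Λ l) f‖ ^ 2) ∧
      ∑' l : Λ, ‖inner ℂ (canonicalDual π g Λ l) f‖ ^ 2 ≤ B * ‖f‖ ^ 2) ∧
    (∀ f f', HasSum (fun l : Λ => inner ℂ f' (π l g) * inner ℂ (canonicalDual π g Λ l) f)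
      (inner ℂ f' f)) ∧
    (∃ C : ℝ, ∀ l, ‖canonicalDual π g Λ l‖ ≤ C) ∧
    ∀ l ∈ Λ, 0 ≤ (inner ℂ (canonicalDual π g Λ l) (π l g)).re ∧
      (inner ℂ (canonicalDual π g Λ l) (π l g)).re ≤ 1 := by
  obtain ⟨S, R, hR, hRS, hSR, hsum, hdual⟩ := hF.exists_frameOperator
  obtain ⟨A, B, hA, hB, h⟩ := hF
  have hsymm : ∀ u v, inner ℂ (R u) v = inner ℂ u (R v) :=
    ContinuousLinearMap.isSelfAdjoint_iff_isSymmetric.1 hR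
  have hcoef : ∀ l f, inner ℂ (canonicalDual π g Λ l) f = coeff π g (R f) l := by
    intro l f
    rw [hdual, hsymm, coeff]
  refine ⟨⟨B * ‖R‖ ^ 2, by positivity, fun f => ?_⟩, fun f f' => ?_,
    ⟨‖R‖ * ‖g‖, fun l => ?_⟩, fun l hl => ?_⟩
  · simp only [hcoef]
    refine ⟨(h _).1, (h _).2.2.trans ?_⟩
    rw [mul_assoc, ← mul_pow]
    gcongr
    exact R.le_opNorm f
  · have h1 := (hsum (R f)).mapL (innerSL ℂ f')
    rw [hSR] at h1
    refine h1.congr_fun fun l => ?_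
    simp [hcoef, mul_comm]
  · rw [hdual]
    simpa using R.le_opNorm (π l g)
  · rw [hdual, hsymm]
    -- Here `s = ⟨S⁻¹e, e⟩` equals `∑ |⟨S⁻¹e, π(k)g⟩|²` over `k ∈ Λ`, whose term at `k = l` is `s²`.
    -- Hence `s² ≤ s`.
    set e := π l g with he
    have h1 := (hsum (R e)).mapL (innerSL ℂ (R e))
    have h2 : inner ℂ (R e) (S (R e)) = ((∑' l : Λ, ‖coeff π g (R e) l‖ ^ 2 : ℝ) : ℂ) := by
      refine h1.unique ?_
      refine (Complex.hasSum_ofReal.2 (h (R e)).1.hasSum).congr_fun fun l => ?_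
      simp only [innerSL_apply_apply, inner_smul_right]
      rw [← inner_conj_symm (R e), ← coeff, Complex.mul_conj']
      push_cast; rfl
    rw [hSR, hsymm] at h2
    set s := ∑' l : Λ, ‖coeff π g (R e) l‖ ^ 2 with hs
    have h3 : ‖coeff π g (R e) l‖ ^ 2 ≤ s :=
      (h (R e)).1.le_tsum ⟨l, hl⟩ fun _ _ => by positivity
    have h4 : coeff π g (R e) l = s := h2
    rw [h4, Complex.norm_real, Real.norm_eq_abs, sq_abs] at h3
    rw [h2, Complex.ofReal_re]
    have h5 : 0 ≤ s := tsum_nonneg fun _ => by positivity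
    refine ⟨h5, ?_⟩
    nlinarith

end Frame

/-! ### Local majorants and sampling over separated sets -/

theorem tsum_indicator_one_eq_encard {α : Type*} (Λ A : Set α) :
    ∑' l : Λ, A.indicator (1 : α → ℝ≥0∞) l = ((Λ ∩ A).encard : ℝ≥0∞) := by
  classical
  rw [tsum_subtype Λ (A.indicator (1 : α → ℝ≥0∞)), Set.indicator_indicator,
    ← tsum_subtype (Λ ∩ A) (1 : α → ℝ≥0∞)]
  exact ENNReal.tsum_set_one _

theorem sq_enorm_eq_ofReal {E : Type*} [SeminormedAddCommGroup E] (a : E) :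
    ‖a‖ₑ ^ 2 = ENNReal.ofReal (‖a‖ ^ 2) := by
  rw [ENNReal.ofReal_pow (norm_nonneg _), ofReal_norm]

/-- By symmetry of `Q`, a translate `lQ` contains `w` exactly when `l ∈ wQ`; so these translates
overlap at most `N`-fold. -/
theorem tsum_indicator_inv_mul_le {G : Type*} [Group G] {Q : Set G} (hQs : Q⁻¹ = Q)
    {Λ : Set G} {N : ℕ} (hN : ∀ x : G, (Λ ∩ x • Q).encard ≤ N) (w : G) :
    ∑' l : Λ, Q.indicator (1 : G → ℝ≥0∞) ((l : G)⁻¹ * w) ≤ N := by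
  have h : ∀ l : Λ, Q.indicator (1 : G → ℝ≥0∞) ((l : G)⁻¹ * w) =
      (w • Q).indicator (1 : G → ℝ≥0∞) l := by
    intro l
    have : (l : G)⁻¹ * w ∈ Q ↔ (l : G) ∈ w • Q := by
      rw [Set.mem_smul_set_iff_inv_smul_mem, smul_eq_mul]
      conv_lhs => rw [← hQs, Set.mem_inv]
      simp
    by_cases hl : (l : G) ∈ w • Q
    · rw [Set.indicator_of_mem hl, Set.indicator_of_mem (this.2 hl)]; rfl
    · rw [Set.indicator_of_notMem hl, Set.indicator_of_notMem (fun h' => hl (this.1 h'))]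
  simp_rw [h]
  rw [tsum_indicator_one_eq_encard]
  exact_mod_cast hN w

section

variable {G : Type*} [Group G] [TopologicalSpace G] [IsTopologicalGroup G]
  [T2Space G] [LocallyCompactSpace G] [SecondCountableTopology G]
  [MeasurableSpace G] [BorelSpace G] {μ : Measure G}

set_option linter.unusedSectionVars false

/-- The finite measure with density `f` is continuous from above along the complements of a compact
exhaustion. -/
theorem exists_isCompact_setLIntegral_compl_le {f : G → ℝ≥0∞}
    (hfi : ∫⁻ x, f x ∂μ ≠ ∞) {ε : ℝ≥0∞} (hε : ε ≠ 0) :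
    ∃ L : Set G, IsCompact L ∧ ∫⁻ x in Lᶜ, f x ∂μ ≤ ε := by
  have hm : ∀ n, MeasurableSet (compactCovering G n) := fun n =>
    (isCompact_compactCovering G n).measurableSet
  have hρ : IsFiniteMeasure (μ.withDensity f) := isFiniteMeasure_withDensity hfi
  have ht := tendsto_measure_iInter_atTop (μ := μ.withDensity f)
    (s := fun n => (compactCovering G n)ᶜ) (fun n => (hm n).compl.nullMeasurableSet)
    (fun m n hmn => Set.compl_subset_compl.2 (compactCovering_subset G hmn))
    ⟨0, measure_ne_top _ _⟩
  rw [← Set.compl_iUnion, iUnion_compactCovering, Set.compl_univ, measure_empty] at ht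
  obtain ⟨n, hn⟩ := ((ENNReal.tendsto_nhds_zero.1 ht) ε (pos_iff_ne_zero.2 hε)).exists
  refine ⟨_, isCompact_compactCovering G n, ?_⟩
  simpa only [Function.comp_apply, withDensity_apply _ (hm n).compl] using hn

variable [μ.IsHaarMeasure] {Q : Set G}

/-- A measurable square-integrable function that controls `F` on translates of `Q`. -/
theorem exists_measurable_majorant [μ.IsMulRightInvariant] (hQc : IsCompact Q) (hQs : Q⁻¹ = Q)
    {F : G → ℂ}
    (hF : StronglyMeasurable F) (hW : F ∈ wienerAmalgam μ Q 2) :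
    ∃ M : G → ℝ≥0∞, Measurable M ∧ ∫⁻ x, M x ^ 2 ∂μ ≠ ∞ ∧
      (∀ᵐ x ∂μ, ∀ᵐ z ∂μ, z ∈ Q → ‖F x‖ₑ ≤ M (x * z)) ∧
      (∀ᵐ z ∂μ, ∀ᵐ x ∂μ, z ∈ Q → ‖F x‖ₑ ≤ M (x * z)) := by
  obtain ⟨-, hM⟩ := hW
  have hM1 := hM.1
  have hMm : Measurable (hM1.mk _) := hM1.stronglyMeasurable_mk.measurable
  have hQm : MeasurableSet Q := hQc.measurableSet
  -- The essential supremum gives the bound for almost every `z` at each `w`. Swapping the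
  -- quantifiers allows the substitution `w = xz` at fixed `z`, by right invariance; a second swap
  -- gives the other form.
  have h1 : ∀ᵐ w ∂μ, ∀ᵐ z ∂μ, z ∈ Q → ‖F (w * z⁻¹)‖ₑ ≤ hM1.mk _ w := by
    filter_upwards [hM1.ae_eq_mk] with w hw
    have h2 : ∀ᵐ z ∂(μ.restrict Q), ‖F (w * z)‖ₑ ≤ localMax μ Q F w := ENNReal.ae_le_essSup _
    rw [ae_restrict_iff' hQm] at h2
    have h3 := (quasiMeasurePreserving_inv μ).ae h2
    filter_upwards [h3] with z hz hzQ
    rw [← hw]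
    exact hz (by rw [← hQs]; exact Set.inv_mem_inv.2 hzQ)
  have hFm : Measurable fun x => ‖F x‖ₑ := hF.measurable.enorm
  have h4 : ∀ᵐ z ∂μ, ∀ᵐ w ∂μ, z ∈ Q → ‖F (w * z⁻¹)‖ₑ ≤ hM1.mk _ w := by
    rw [Measure.ae_ae_comm] at h1
    · exact h1
    · have e : {x : G × G | x.2 ∈ Q → ‖F (x.1 * x.2⁻¹)‖ₑ ≤ hM1.mk _ x.1} =
          {x : G × G | x.2 ∈ Q}ᶜ ∪ {x : G × G | ‖F (x.1 * x.2⁻¹)‖ₑ ≤ hM1.mk _ x.1} := by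
        ext x; simp [imp_iff_not_or]
      rw [e]
      exact (measurable_snd hQm).compl.union (measurableSet_le
        (hFm.comp (measurable_fst.mul measurable_snd.inv)) (hMm.comp measurable_fst))
  have h5 : ∀ᵐ z ∂μ, ∀ᵐ x ∂μ, z ∈ Q → ‖F x‖ₑ ≤ hM1.mk _ (x * z) := by
    filter_upwards [h4] with z hz
    have := (measurePreserving_mul_right μ z).quasiMeasurePreserving.ae hz
    simpa using this
  refine ⟨hM1.mk _, hMm, ?_, ?_, h5⟩
  · have h6 : eLpNorm (hM1.mk _) 2 μ < ∞ := by
      rw [← eLpNorm_congr_ae hM1.ae_eq_mk]; exact hM.2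
    rw [eLpNorm_lt_top_iff_lintegral_rpow_enorm_lt_top (by norm_num) (by norm_num)] at h6
    simpa using h6.ne
  · rw [Measure.ae_ae_comm] at h5
    · exact h5
    · have e : {x : G × G | x.1 ∈ Q → ‖F x.2‖ₑ ≤ hM1.mk _ (x.2 * x.1)} =
          {x : G × G | x.1 ∈ Q}ᶜ ∪ {x : G × G | ‖F x.2‖ₑ ≤ hM1.mk _ (x.2 * x.1)} := by
        ext x; simp [imp_iff_not_or]
      rw [e]
      exact (measurable_fst hQm).compl.union (measurableSet_le
        (hFm.comp measurable_snd) (hMm.comp (measurable_snd.mul measurable_fst)))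

/-- As `Q` has positive measure, some `z ∈ Q` is not exceptional, and `F` is dominated by the right
translate of `M` by that `z`. -/
theorem memLp_two_of_majorant [μ.IsMulRightInvariant] (hQ : Q ∈ 𝓝 (1 : G))
    {F : G → ℂ} (hF : StronglyMeasurable F)
    {M : G → ℝ≥0∞} (hM : ∫⁻ x, M x ^ 2 ∂μ ≠ ∞)
    (h : ∀ᵐ z ∂μ, ∀ᵐ x ∂μ, z ∈ Q → ‖F x‖ₑ ≤ M (x * z)) : MemLp F 2 μ := by
  have hpos : μ Q ≠ 0 := (Measure.measure_pos_of_mem_nhds μ hQ).ne'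
  obtain ⟨z, hzQ, hz⟩ : ∃ z, z ∈ Q ∧ ∀ᵐ x ∂μ, ‖F x‖ₑ ≤ M (x * z) := by
    by_contra hcon
    refine hpos (measure_mono_null (fun z hz => ?_) h)
    intro h'
    refine hcon ⟨z, hz, ?_⟩
    filter_upwards [h'] with x hx using hx hz
  refine ⟨hF.aestronglyMeasurable, ?_⟩
  rw [eLpNorm_lt_top_iff_lintegral_rpow_enorm_lt_top (by norm_num) (by norm_num)]
  refine lt_of_le_of_lt (lintegral_mono_ae (g := fun x => M (x * z) ^ 2) ?_) ?_
  · filter_upwards [hz] with x hx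
    simpa using pow_le_pow_left' hx 2
  · rw [lintegral_mul_right_eq_self (fun x => M x ^ 2)]
    exact hM.lt_top

/-- Sampling a function with a local majorant over a separated set away from a large set. -/
theorem ae_tsum_indicator_le (hQc : IsCompact Q) (hQs : Q⁻¹ = Q)
    {F : G → ℂ} {M : G → ℝ≥0∞} (hM : Measurable M)
    (h : ∀ᵐ x ∂μ, ∀ᵐ z ∂μ, z ∈ Q → ‖F x‖ₑ ≤ M (x * z))
    [μ.IsMulRightInvariant] {Λ : Set G} (hΛ : Λ.Countable) {N : ℕ}
    (hN : ∀ x : G, (Λ ∩ x • Q).encard ≤ N) {L : Set G} (hL : IsCompact L) :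
    ∀ᵐ y ∂μ, μ Q * ∑' l : Λ, (L * Q)ᶜ.indicator (fun x => ‖F x‖ₑ ^ 2) (y⁻¹ * l) ≤
      N * ∫⁻ x in Lᶜ, M x ^ 2 ∂μ := by
  have := hΛ.to_subtype
  have hQm : MeasurableSet Q := hQc.measurableSet
  have hLm : MeasurableSet Lᶜ := hL.measurableSet.compl
  -- The majorant holds only almost everywhere; countability of `Λ` lets almost every `y` serve all
  -- sample points at once.
  have h1 : ∀ᵐ y ∂μ, ∀ l : Λ, ∀ᵐ z ∂μ, z ∈ Q → ‖F (y⁻¹ * l)‖ₑ ≤ M (y⁻¹ * l * z) := by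
    rw [ae_all_iff]
    intro l
    exact ((measurePreserving_mul_right μ (l : G)).quasiMeasurePreserving.comp
      (quasiMeasurePreserving_inv μ)).ae h
  filter_upwards [h1] with y hy
  set m : G → ℝ≥0∞ := Lᶜ.indicator fun x => M x ^ 2 with hm
  have hmm : Measurable m := (hM.pow_const 2).indicator hLm
  -- Each sample is replaced by an integral of `M²` over `y⁻¹lQ`, which misses `L` when `y⁻¹l ∉ LQ`.
  have h2 : ∀ l : Λ, μ Q * (L * Q)ᶜ.indicator (fun x => ‖F x‖ₑ ^ 2) (y⁻¹ * l) ≤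
      ∫⁻ w, Q.indicator 1 ((l : G)⁻¹ * w) * m (y⁻¹ * w) ∂μ := by
    intro l
    by_cases hl : y⁻¹ * l ∈ L * Q
    · simp [hl]
    rw [Set.indicator_of_mem (by exact hl), mul_comm, ← setLIntegral_const,
      ← lintegral_mul_left_eq_self (μ := μ) (fun w => Q.indicator 1 ((l : G)⁻¹ * w) * m (y⁻¹ * w))
        (l : G), ← lintegral_indicator hQm]
    refine lintegral_mono_ae ?_
    filter_upwards [hy l] with z hz
    by_cases hzQ : z ∈ Q
    · have hnot : y⁻¹ * (l * z) ∉ L := fun hmem => hl <| by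
        refine ⟨_, hmem, z⁻¹, by rw [← hQs]; exact Set.inv_mem_inv.2 hzQ, ?_⟩
        group
      simp only [hzQ, Set.indicator_of_mem, inv_mul_cancel_left, Pi.one_apply, one_mul, hm]
      rw [Set.indicator_of_mem (by exact hnot), ← mul_assoc]
      exact pow_le_pow_left' (hz hzQ) 2
    · simp [hzQ]
  rw [← ENNReal.tsum_mul_left]
  refine (ENNReal.tsum_le_tsum h2).trans ?_
  have hind : ∀ l : Λ, Measurable fun w : G => Q.indicator (1 : G → ℝ≥0∞) ((l : G)⁻¹ * w) :=
    fun l => (measurable_one.indicator hQm).comp (measurable_const_mul _)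
  have hmul : ∀ l : Λ, Measurable fun w : G =>
      Q.indicator (1 : G → ℝ≥0∞) ((l : G)⁻¹ * w) * m (y⁻¹ * w) :=
    fun l => (hind l).mul (hmm.comp (measurable_const_mul _))
  rw [← lintegral_tsum fun l => (hmul l).aemeasurable]
  have h3 : ∀ w, ∑' l : Λ, Q.indicator (1 : G → ℝ≥0∞) ((l : G)⁻¹ * w) * m (y⁻¹ * w) ≤
      N * m (y⁻¹ * w) := by
    intro w
    rw [ENNReal.tsum_mul_right]
    gcongr
    exact tsum_indicator_inv_mul_le hQs hN w
  refine (lintegral_mono h3).trans ?_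
  rw [lintegral_const_mul' _ _ (ENNReal.natCast_ne_top N),
    lintegral_mul_left_eq_self m, hm, lintegral_indicator hLm]

end

/-! ### Counting points and uniform tails -/

section

variable {G : Type*} [Group G] [TopologicalSpace G] [IsTopologicalGroup G]
  [T2Space G] [LocallyCompactSpace G] [SecondCountableTopology G]
  [MeasurableSpace G] [BorelSpace G] {μ : Measure G} [μ.IsHaarMeasure] {Q Λ : Set G}

set_option linter.unusedSectionVars false

/-- The number of points of a separated set in `A` is controlled by the measure of `A * Q`. -/
theorem encard_mul_measure_le (hQc : IsCompact Q) (hQs : Q⁻¹ = Q) (hΛ : Λ.Countable) {N : ℕ}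
    (hN : ∀ x : G, (Λ ∩ x • Q).encard ≤ N) (A : Set G) :
    ((Λ ∩ A).encard : ℝ≥0∞) * μ Q ≤ N * μ (A * Q) := by
  have := hΛ.to_subtype
  have hQm : MeasurableSet Q := hQc.measurableSet
  have hind : ∀ l : Λ, Measurable fun w : G => Q.indicator (1 : G → ℝ≥0∞) ((l : G)⁻¹ * w) :=
    fun l => (measurable_one.indicator hQm).comp (measurable_const_mul _)
  have h1 : ∀ l : Λ, A.indicator (1 : G → ℝ≥0∞) l * μ Q =
      ∫⁻ w, A.indicator (1 : G → ℝ≥0∞) l * Q.indicator 1 ((l : G)⁻¹ * w) ∂μ := by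
    intro l
    rw [lintegral_const_mul _ (hind l), lintegral_mul_left_eq_self (Q.indicator 1),
      lintegral_indicator_one hQm]
  rw [← tsum_indicator_one_eq_encard, ← ENNReal.tsum_mul_right]
  simp_rw [h1]
  rw [← lintegral_tsum fun l => ((hind l).const_mul _).aemeasurable]
  -- `A * Q` need not be measurable, hence its measurable hull.
  have h2 : ∀ w, ∑' l : Λ, A.indicator (1 : G → ℝ≥0∞) l * Q.indicator 1 ((l : G)⁻¹ * w) ≤
      (toMeasurable μ (A * Q)).indicator (fun _ => (N : ℝ≥0∞)) w := by
    intro w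
    by_cases hw : w ∈ toMeasurable μ (A * Q)
    · rw [Set.indicator_of_mem hw]
      refine le_trans (ENNReal.tsum_le_tsum fun l => ?_) (tsum_indicator_inv_mul_le hQs hN w)
      refine mul_le_of_le_one_left' ?_
      exact Set.indicator_le_self' (fun _ _ => zero_le) _
    · rw [Set.indicator_of_notMem hw, nonpos_iff_eq_zero, ENNReal.tsum_eq_zero]
      intro l
      by_contra h
      have hl : (l : G) ∈ A := Set.mem_of_indicator_ne_zero (left_ne_zero_of_mul h)
      have hl' : (l : G)⁻¹ * w ∈ Q := Set.mem_of_indicator_ne_zero (right_ne_zero_of_mul h)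
      exact hw (subset_toMeasurable _ _ ⟨_, hl, _, hl', by simp⟩)
  refine (lintegral_mono h2).trans ?_
  rw [lintegral_indicator (measurableSet_toMeasurable _ _), setLIntegral_const,
    measure_toMeasurable]

/-- A set along which a non-zero function has uniformly square-summable samples has
uniformly few points in translates of a compact set. -/
theorem exists_encard_inter_smul_le (hΛ : Λ.Countable) {F : G → ℂ} (hF : StronglyMeasurable F)
    (hF0 : ∫⁻ x, ‖F x‖ₑ ^ 2 ∂μ ≠ 0) (hFi : ∫⁻ x, ‖F x‖ₑ ^ 2 ∂μ ≠ ∞) {B : ℝ≥0∞} (hB : B ≠ ∞)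
    (h : ∀ y, ∑' l : Λ, ‖F ((l : G)⁻¹ * y)‖ₑ ^ 2 ≤ B) {K : Set G} (hK : IsCompact K) :
    ∃ N : ℕ, ∀ x : G, (Λ ∩ x • K).encard ≤ N := by
  have := hΛ.to_subtype
  -- `W` carries positive mass `I`. Every point of `Λ ∩ xK` contributes at least `I` to an integral
  -- over `xKW`, and the sampling bound caps the total by `B μ(KW)`.
  obtain ⟨W, hW, hWε⟩ := exists_isCompact_setLIntegral_compl_le hFi (ENNReal.half_pos hF0).ne'
  have hFm : Measurable fun x => ‖F x‖ₑ ^ 2 := hF.measurable.enorm.pow_const 2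
  set I := ∫⁻ x in W, ‖F x‖ₑ ^ 2 ∂μ with hI
  have hI0 : I ≠ 0 := by
    intro h0
    have h1 := lintegral_add_compl (μ := μ) (fun x => ‖F x‖ₑ ^ 2) hW.measurableSet
    rw [← hI, h0, zero_add] at h1
    rw [h1] at hWε
    exact absurd hWε (not_le.2 (ENNReal.half_lt_self hF0 hFi))
  have hKW : IsCompact (K * W) := hK.mul hW
  obtain ⟨N, hN⟩ := ENNReal.exists_nat_gt (r := B * μ (K * W) / I)
    (ENNReal.div_ne_top (ENNReal.mul_ne_top hB hKW.measure_lt_top.ne) hI0)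
  refine ⟨N, fun x => ?_⟩
  have hm : MeasurableSet (x • (K * W)) := (hKW.smul x).measurableSet
  have hWm := hW.measurableSet
  have h1 : ∀ l : Λ, (x • K).indicator (1 : G → ℝ≥0∞) l * I ≤
      ∫⁻ y in x • (K * W), ‖F ((l : G)⁻¹ * y)‖ₑ ^ 2 ∂μ := by
    intro l
    by_cases hl : (l : G) ∈ x • K
    · rw [Set.indicator_of_mem hl, Pi.one_apply, one_mul, hI, ← lintegral_indicator hWm,
        ← lintegral_mul_left_eq_self (μ := μ) _ (l : G)⁻¹, ← lintegral_indicator hm]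
      refine lintegral_mono fun y => ?_
      by_cases hy : (l : G)⁻¹ * y ∈ W
      · have hy' : y ∈ x • (K * W) := by
          rw [← smul_mul_assoc]
          exact ⟨_, hl, _, hy, by simp⟩
        rw [Set.indicator_of_mem hy, Set.indicator_of_mem hy']
      · rw [Set.indicator_of_notMem hy]; exact zero_le
    · rw [Set.indicator_of_notMem hl, zero_mul]; exact zero_le
  have h2 : ((Λ ∩ x • K).encard : ℝ≥0∞) * I ≤ B * μ (K * W) := by
    rw [← tsum_indicator_one_eq_encard, ← ENNReal.tsum_mul_right]
    refine (ENNReal.tsum_le_tsum h1).trans ?_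
    have hFl : ∀ l : Λ, Measurable fun y => ‖F ((l : G)⁻¹ * y)‖ₑ ^ 2 :=
      fun l => hFm.comp (measurable_const_mul _)
    rw [← lintegral_tsum fun l => (hFl l).aemeasurable]
    refine (lintegral_mono h).trans ?_
    rw [setLIntegral_const, measure_smul]
  have h3 : ((Λ ∩ x • K).encard : ℝ≥0∞) ≤ (N : ℝ≥0∞) :=
    (ENNReal.le_div_iff_mul_le (.inl hI0) (.inr (ENNReal.mul_ne_top hB hKW.measure_lt_top.ne))).2 h2
      |>.trans hN.le
  exact_mod_cast h3

/-- Uniform smallness of the samples, and of the integral, of `F` off a compact set. -/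
theorem exists_isCompact_tail_le [μ.IsMulRightInvariant] (hQc : IsCompact Q) (hQs : Q⁻¹ = Q)
    (hQ : Q ∈ 𝓝 (1 : G)) {F : G → ℂ} (hF : StronglyMeasurable F)
    (hW : F ∈ wienerAmalgam μ Q 2) (hΛ : Λ.Countable) {N : ℕ}
    (hN : ∀ x : G, (Λ ∩ x • Q).encard ≤ N) {ε : ℝ≥0∞} (hε : ε ≠ 0) :
    ∃ L : Set G, IsCompact L ∧ 1 ∈ L ∧ L⁻¹ = L ∧ ∫⁻ x in Lᶜ, ‖F x‖ₑ ^ 2 ∂μ ≤ ε ∧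
      ∀ᵐ y ∂μ, ∑' l : Λ, Lᶜ.indicator (fun x => ‖F x‖ₑ ^ 2) (y⁻¹ * l) ≤ ε := by
  obtain ⟨M, hM, hMi, h1, h2⟩ := exists_measurable_majorant hQc hQs hF hW
  have hFi : ∫⁻ x, ‖F x‖ₑ ^ 2 ∂μ ≠ ∞ := by
    have h3 := (memLp_two_of_majorant hQ hF hMi h2).2
    rw [eLpNorm_lt_top_iff_lintegral_rpow_enorm_lt_top (by norm_num) (by norm_num)] at h3
    simpa using h3.ne
  have hQ0 : μ Q ≠ 0 := (Measure.measure_pos_of_mem_nhds μ hQ).ne'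
  have hQi : μ Q ≠ ∞ := hQc.measure_lt_top.ne
  obtain ⟨L₁, hL₁, hε₁⟩ := exists_isCompact_setLIntegral_compl_le hFi hε
  -- This cancels the factor `N / μ(Q)` of the sampling estimate; `N + 1` avoids dividing by zero.
  have hδ : ε * μ Q / (N + 1 : ℕ) ≠ 0 := by
    refine (ENNReal.div_pos (mul_ne_zero hε hQ0) (ENNReal.natCast_ne_top _)).ne'
  obtain ⟨L₂, hL₂, hε₂⟩ := exists_isCompact_setLIntegral_compl_le hMi hδ
  have h3 := ae_tsum_indicator_le hQc hQs hM h1 hΛ hN hL₂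
  let L₀ : Set G := L₁ ∪ L₂ * Q ∪ {1}
  let L : Set G := L₀ ∪ L₀⁻¹
  have hL₀ : IsCompact L₀ := (hL₁.union (hL₂.mul hQc)).union isCompact_singleton
  have hsub : L₀ ⊆ L := Set.subset_union_left
  refine ⟨L, hL₀.union hL₀.inv, hsub (by simp [L₀]), ?_, ?_, ?_⟩
  · simp only [L]
    rw [Set.union_inv, inv_inv, Set.union_comm]
  · refine (lintegral_mono_set ?_).trans hε₁
    exact Set.compl_subset_compl.2 fun x hx => hsub (.inl (.inl hx))
  · filter_upwards [h3] with y hy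
    have h4 : μ Q * ∑' l : Λ, Lᶜ.indicator (fun x => ‖F x‖ₑ ^ 2) (y⁻¹ * l) ≤ μ Q * ε := by
      calc _ ≤ μ Q * ∑' l : Λ, (L₂ * Q)ᶜ.indicator (fun x => ‖F x‖ₑ ^ 2) (y⁻¹ * l) := by
            gcongr
            exact fun x hx => hsub (.inl (.inr hx))
        _ ≤ N * (ε * μ Q / (N + 1 : ℕ)) := hy.trans (by gcongr)
        _ ≤ (N + 1 : ℕ) * (ε * μ Q / (N + 1 : ℕ)) := by gcongr; simp
        _ = μ Q * ε := by
            rw [ENNReal.mul_div_cancel (by simp) (ENNReal.natCast_ne_top _), mul_comm]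
    exact (ENNReal.mul_le_mul_iff_right hQ0 hQi).1 h4

end

/-! ### The trace estimate -/

theorem norm_mul_le_weighted {δ : ℝ} (hδ : 0 < δ) (a b : ℂ) :
    ‖a * b‖ ≤ δ * ‖a‖ ^ 2 + δ⁻¹ * ‖b‖ ^ 2 := by
  rw [norm_mul]
  have h1 : δ * ‖a‖ ^ 2 + δ⁻¹ * ‖b‖ ^ 2 - ‖a‖ * ‖b‖ =
      δ⁻¹ * ((δ * ‖a‖ - ‖b‖ / 2) ^ 2 + 3 / 4 * ‖b‖ ^ 2) := by
    field_simp
    ring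
  have h2 : 0 ≤ δ⁻¹ * ((δ * ‖a‖ - ‖b‖ / 2) ^ 2 + 3 / 4 * ‖b‖ ^ 2) := by positivity
  linarith

/-- A weighted substitute for Cauchy–Schwarz: with `δ = ε`, a tail bound `B = ε²` yields an error of
order `ε`. -/
theorem norm_hasSum_mul_le {ι : Type*} {a b : ι → ℂ} {z : ℂ} (h : HasSum (fun i => a i * b i) z)
    {A B : ℝ} (ha : Summable fun i => ‖a i‖ ^ 2) (hA : ∑' i, ‖a i‖ ^ 2 ≤ A)
    (hb : Summable fun i => ‖b i‖ ^ 2) (hB : ∑' i, ‖b i‖ ^ 2 ≤ B) {δ : ℝ} (hδ : 0 < δ) :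
    ‖z‖ ≤ δ * A + δ⁻¹ * B := by
  have h1 := (ha.hasSum.mul_left δ).add (hb.hasSum.mul_left δ⁻¹)
  refine (h.norm_le_of_bounded h1 fun i => norm_mul_le_weighted hδ _ _).trans ?_
  gcongr

theorem tsum_subtype_le_of_nonneg {ι : Type*} {f : ι → ℝ} (hf : ∀ i, 0 ≤ f i) (hs : Summable f)
    (p : ι → Prop) : ∑' i : {i // p i}, f i ≤ ∑' i, f i :=
  tsum_comp_le_tsum_of_inj hs hf Subtype.val_injective

section

variable {G : Type*} [Group G] [TopologicalSpace G] [IsTopologicalGroup G]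
  [T2Space G] [LocallyCompactSpace G] [SecondCountableTopology G]
  [MeasurableSpace G] [BorelSpace G] {μ : Measure G} [μ.IsHaarMeasure]
  {H : Type*} [NormedAddCommGroup H] [InnerProductSpace ℂ H] [CompleteSpace H]
  {π : G → H ≃ₗᵢ[ℂ] H} {g : H} {Q Λ : Set G}

set_option linter.unusedSectionVars false

/-- Comparison of the truncated frame expansion with its continuous counterpart: the error is
concentrated near the boundary of `E`. -/
theorem exists_trace_estimate (hπ : IsProjectiveRep π) {c : ℝ}
    (hc : ∀ f, MemLp (coeff π g f) 2 μ ∧ ∫ y, ‖coeff π g f y‖ ^ 2 ∂μ = c * ‖f‖ ^ 2)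
    (hc0 : 0 < c) (hF : IsCoherentFrame π g Λ)
    (htail : ∀ ε : ℝ≥0∞, ε ≠ 0 → ∃ L : Set G, IsCompact L ∧ 1 ∈ L ∧ L⁻¹ = L ∧
      ∫⁻ x in Lᶜ, ‖coeff π g g x‖ₑ ^ 2 ∂μ ≤ ε ∧
      ∀ᵐ y ∂μ, ∑' l : Λ, Lᶜ.indicator (fun x => ‖coeff π g g x‖ₑ ^ 2) (y⁻¹ * l) ≤ ε) :
    ∃ C : ℝ, 0 < C ∧ ∀ ε : ℝ, 0 < ε → ∃ L : Set G, IsCompact L ∧ 1 ∈ L ∧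
      ∀ E : Set G, IsCompact E → ∀ s : Finset Λ, (∀ l, l ∈ s ↔ (l : G) ∈ E) →
      ∀ s' : Finset Λ, (∀ l, l ∈ s' ↔ (l : G) ∈ E ∩ (Eᶜ * L)) →
        |c * ∑ l ∈ s, (inner ℂ (canonicalDual π g Λ l) (π l g)).re - ‖g‖ ^ 2 * μ.real E| ≤
          C * (ε * μ.real E + μ.real (E ∩ (Eᶜ * L)) + ε * s.card + s'.card) := by
  classical
  obtain ⟨⟨B₁, hB₁, hd⟩, hrec, ⟨C₃, hC₃⟩, -⟩ := hF.canonicalDual_spec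
  obtain ⟨A, B₂, -, hB₂, hfr⟩ := hF
  set d := canonicalDual π g Λ with hddef
  set G2 : ℝ := ‖g‖ ^ 2 with hG2
  have hG2nn : 0 ≤ G2 := by positivity
  refine ⟨(B₁ + B₂) * G2 + (B₁ * G2 + 1) + (c * C₃ ^ 2 + 1) + (c * C₃ ^ 2 + c * G2),
    by positivity, fun ε hε => ?_⟩
  obtain ⟨L, hL, h1L, hLs, hL1, hL2⟩ := htail (ENNReal.ofReal (ε ^ 2))
    (ENNReal.ofReal_pos.2 (by positivity)).ne'
  refine ⟨L, hL, h1L, fun E hE s hs s' hs' => ?_⟩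
  have hEm : MeasurableSet E := hE.measurableSet
  have hbo : IsOpen (Eᶜ * L) := hE.isClosed.isOpen_compl.mul_right
  have hEfin : μ E ≠ ∞ := hE.measure_lt_top.ne
  let a : Λ → G → ℂ := fun l y => (starRingEnd ℂ) (coeff π g (d l) y) * coeff π g (π l g) y
  have hai : ∀ l, Integrable (a l) μ := fun l => integrable_conj_mul (hc _).1 (hc _).1
  have haI : ∀ l, ∫ y, a l y ∂μ = c * inner ℂ (d l) (π l g) := fun l =>
    integral_conj_coeff_mul_coeff hc _ _
  -- By reconstruction of `π(y)g`, `r y` is the part of the expansion of `‖g‖²` carried by the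
  -- points of `Λ` outside `E`.
  let r : G → ℂ := fun y => (G2 : ℂ) - ∑ l ∈ s, a l y
  have hrsum : ∀ y, HasSum (fun l : {l // l ∉ s} => inner ℂ (d l.1) (π y g) *
      coeff π g (π l.1 g) y) (r y) := by
    intro y
    have h1 := hrec (π y g) (π y g)
    rw [inner_self_eq_ofReal, LinearIsometryEquiv.norm_map] at h1
    have h2 : HasSum (fun l : Λ => inner ℂ (d l) (π y g) * coeff π g (π l g) y) (G2 : ℂ) := by
      refine h1.congr_fun fun l => ?_
      rw [mul_comm]; rfl
    refine (Finset.hasSum_compl_iff (f := fun l : Λ => inner ℂ (d l) (π y g) *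
      coeff π g (π l g) y) s).2 ?_
    have h3 : r y + ∑ l ∈ s, inner ℂ (d l) (π y g) * coeff π g (π l g) y = G2 := by
      simp only [r, a, coeff, inner_conj_symm, sub_add_cancel]
    exact (congrArg (HasSum _) h3).mpr h2
  have hT : ∀ y, Summable (fun l : Λ => ‖coeff π g (π l g) y‖ ^ 2) ∧
      ∑' l : Λ, ‖coeff π g (π l g) y‖ ^ 2 ≤ B₂ * G2 := by
    intro y
    have h1 := hfr (π y g)
    have h2 : ∀ l : Λ, ‖coeff π g (π y g) l‖ = ‖coeff π g (π l g) y‖ := fun l => by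
      rw [coeff, coeff, norm_inner_symm]
    simp only [h2, LinearIsometryEquiv.norm_map] at h1
    exact ⟨h1.1, h1.2.2⟩
  have hdy : ∀ y, Summable (fun l : {l // l ∉ s} => ‖inner ℂ (d l.1) (π y g)‖ ^ 2) ∧
      ∑' l : {l // l ∉ s}, ‖inner ℂ (d l.1) (π y g)‖ ^ 2 ≤ B₁ * G2 := by
    intro y
    have h1 := hd (π y g)
    rw [LinearIsometryEquiv.norm_map] at h1
    exact ⟨h1.1.subtype _, (tsum_subtype_le_of_nonneg (fun _ => by positivity) h1.1 _).trans h1.2⟩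
  have hr1 : ∀ y, ‖r y‖ ≤ (B₁ + B₂) * G2 := by
    intro y
    have h1 := norm_hasSum_mul_le (hrsum y) (hdy y).1 (hdy y).2 ((hT y).1.subtype _)
      ((tsum_subtype_le_of_nonneg (fun _ => by positivity) (hT y).1 _).trans (hT y).2) one_pos
    linarith
  -- For `y` deep inside `E`, every `l ∉ E` has `y⁻¹l ∉ L`, so the sampled tail applies.
  have hr2 : ∀ᵐ y ∂μ, y ∈ E → y ∉ Eᶜ * L → ‖r y‖ ≤ (B₁ * G2 + 1) * ε := by
    filter_upwards [hL2] with y hy hyE hyL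
    have h1 : ∑' l : {l // l ∉ s}, ‖coeff π g (π l.1 g) y‖ ^ 2 ≤ ε ^ 2 := by
      refine (ENNReal.ofReal_le_ofReal_iff (by positivity)).1 (le_trans ?_ hy)
      have hsm : Summable fun l : {l // l ∉ s} => ‖coeff π g (π l.1 g) y‖ ^ 2 :=
        (hT y).1.subtype _
      rw [ENNReal.ofReal_tsum_of_nonneg (fun _ => by positivity) hsm]
      refine le_trans (ENNReal.tsum_le_tsum fun l => ?_) (ENNReal.tsum_comp_le_tsum_of_injective
        (Subtype.val_injective (p := fun l : Λ => l ∉ s))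
        fun l : Λ => Lᶜ.indicator (fun x => ‖coeff π g g x‖ₑ ^ 2) (y⁻¹ * l))
      have hl : y⁻¹ * (l.1 : G) ∈ Lᶜ := fun hmem => hyL <| by
        have hlE : (l.1 : G) ∈ Eᶜ := fun h => l.2 ((hs _).2 h)
        refine ⟨_, hlE, (y⁻¹ * (l.1 : G))⁻¹, by rw [← hLs]; exact Set.inv_mem_inv.2 hmem, ?_⟩
        simp
      rw [Set.indicator_of_mem hl, sq_enorm_eq_ofReal, norm_coeff_apply_swap hπ]
    have h2 := norm_hasSum_mul_le (hrsum y) (hdy y).1 (hdy y).2 ((hT y).1.subtype _) h1 hε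
    have h3 : ε⁻¹ * ε ^ 2 = ε := by field_simp
    rw [h3] at h2
    linarith
  have hrI : ‖∫ y in E, r y ∂μ‖ ≤ (B₁ * G2 + 1) * ε * μ.real E +
      (B₁ + B₂) * G2 * μ.real (E ∩ (Eᶜ * L)) := by
    have h1 : Integrable (fun y => (B₁ * G2 + 1) * ε +
        (Eᶜ * L).indicator (fun _ => (B₁ + B₂) * G2) y) (μ.restrict E) := by
      have : IsFiniteMeasure (μ.restrict E) := ⟨by simpa using hEfin.lt_top⟩
      exact (integrable_const _).add ((integrable_const _).indicator hbo.measurableSet)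
    have h2 := norm_integral_le_of_norm_le h1 (f := r) (by
      rw [ae_restrict_iff' hEm]
      filter_upwards [hr2] with y hy hyE
      by_cases hyL : y ∈ Eᶜ * L
      · rw [Set.indicator_of_mem hyL]
        have := hr1 y
        have : 0 ≤ (B₁ * G2 + 1) * ε := by positivity
        linarith
      · rw [Set.indicator_of_notMem hyL, add_zero]
        exact hy hyE hyL)
    refine h2.trans (le_of_eq ?_)
    have : IsFiniteMeasure (μ.restrict E) := ⟨by simpa using hEfin.lt_top⟩
    rw [integral_add (integrable_const _) ((integrable_const _).indicator hbo.measurableSet),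
      integral_indicator_const _ hbo.measurableSet, setIntegral_const,
      measureReal_restrict_apply hbo.measurableSet, Set.inter_comm, smul_eq_mul, smul_eq_mul]
    ring
  have hrE : ∫ y in E, r y ∂μ = G2 * μ.real E - ∑ l ∈ s, ∫ y in E, a l y ∂μ := by
    have : IsFiniteMeasure (μ.restrict E) := ⟨by simpa using hEfin.lt_top⟩
    rw [integral_sub (integrable_const _) (integrable_finsetSum _ fun l _ => (hai l).integrableOn),
      integral_finsetSum _ fun l _ => (hai l).integrableOn, setIntegral_const]
    simp [mul_comm]
  -- The total error splits into `l` inside with `y` outside `E`, and `l` outside with `y` inside.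
  have hmain : (c : ℂ) * ∑ l ∈ s, inner ℂ (d l) (π l g) - G2 * μ.real E =
      ∑ l ∈ s, ∫ y in Eᶜ, a l y ∂μ - ∫ y in E, r y ∂μ := by
    have h1 : (c : ℂ) * ∑ l ∈ s, inner ℂ (d l) (π l g) =
        ∑ l ∈ s, (∫ y in E, a l y ∂μ + ∫ y in Eᶜ, a l y ∂μ) := by
      rw [Finset.mul_sum]
      refine Finset.sum_congr rfl fun l _ => ?_
      rw [integral_add_compl hEm (hai l), haI]
    rw [h1, hrE, Finset.sum_add_distrib]
    ring
  have hout : ∀ l ∈ s, ∀ δ : ℝ, 0 < δ → ‖∫ y in Eᶜ, a l y ∂μ‖ ≤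
      δ * (c * C₃ ^ 2) + δ⁻¹ * ∫ y in Eᶜ, ‖coeff π g (π l g) y‖ ^ 2 ∂μ := by
    intro l _ δ hδ
    have i1 : Integrable (fun y => ‖coeff π g (d l) y‖ ^ 2) μ :=
      (memLp_two_iff_integrable_sq_norm (hc _).1.1).1 (hc _).1
    have i2 : Integrable (fun y => ‖coeff π g (π l g) y‖ ^ 2) μ :=
      (memLp_two_iff_integrable_sq_norm (hc _).1.1).1 (hc _).1
    have h1 := norm_integral_le_of_norm_le (μ := μ.restrict Eᶜ) (f := a l)
      ((i1.integrableOn.const_mul δ).add (i2.integrableOn.const_mul δ⁻¹))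
      (ae_of_all _ fun y => by
        have := norm_mul_le_weighted hδ ((starRingEnd ℂ) (coeff π g (d l) y)) (coeff π g (π l g) y)
        rwa [RCLike.norm_conj] at this)
    refine h1.trans ?_
    simp only [Pi.add_apply]
    rw [integral_add (i1.integrableOn.const_mul δ) (i2.integrableOn.const_mul δ⁻¹),
      integral_const_mul, integral_const_mul]
    gcongr
    refine (setIntegral_le_integral i1 (ae_of_all _ fun y => by positivity)).trans ?_
    rw [(hc _).2]
    gcongr
    exact hC₃ _
  have hout1 : ∀ l ∈ s, ‖∫ y in Eᶜ, a l y ∂μ‖ ≤ c * C₃ ^ 2 + c * G2 := by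
    intro l hl
    have h1 := hout l hl 1 one_pos
    have i2 : Integrable (fun y => ‖coeff π g (π l g) y‖ ^ 2) μ :=
      (memLp_two_iff_integrable_sq_norm (hc _).1.1).1 (hc _).1
    have h2 := setIntegral_le_integral (s := Eᶜ) i2 (ae_of_all _ fun y => by positivity)
    rw [(hc _).2, LinearIsometryEquiv.norm_map] at h2
    linarith
  -- For `l` deep inside `E`, every `y ∉ E` has `l⁻¹y ∉ L`, so the integral tail applies; the
  -- remaining points, those of `s'`, get the crude bound `hout1`.
  have hout2 : ∀ l ∈ s, l ∉ s' → ‖∫ y in Eᶜ, a l y ∂μ‖ ≤ (c * C₃ ^ 2 + 1) * ε := by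
    intro l hl hl'
    have hlL : (l : G) ∉ Eᶜ * L := fun h => hl' ((hs' l).2 ⟨(hs l).1 hl, h⟩)
    have h1 := hout l hl ε hε
    have h2 : ∫ y in Eᶜ, ‖coeff π g (π l g) y‖ ^ 2 ∂μ ≤ ε ^ 2 := by
      have hm : AEStronglyMeasurable (fun y => ‖coeff π g (π l g) y‖ ^ 2) (μ.restrict Eᶜ) :=
        ((hc _).1.1.norm.pow 2).restrict
      rw [integral_eq_lintegral_of_nonneg_ae (ae_of_all _ fun y => by positivity) hm]
      refine ENNReal.toReal_le_of_le_ofReal (by positivity) (le_trans ?_ hL1)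
      rw [← lintegral_indicator hL.measurableSet.compl,
        ← lintegral_mul_left_eq_self (μ := μ) _ (l : G)⁻¹, ← lintegral_indicator hEm.compl]
      refine lintegral_mono fun y => ?_
      by_cases hy : y ∈ Eᶜ
      · have hyL : (l : G)⁻¹ * y ∈ Lᶜ := fun hmem => hlL <| by
          refine ⟨_, hy, ((l : G)⁻¹ * y)⁻¹, by rw [← hLs]; exact Set.inv_mem_inv.2 hmem, ?_⟩
          simp
        rw [Set.indicator_of_mem hy, Set.indicator_of_mem hyL, sq_enorm_eq_ofReal,
          norm_coeff_apply hπ]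
      · rw [Set.indicator_of_notMem hy]; exact zero_le
    have h3 : ε⁻¹ * ∫ y in Eᶜ, ‖coeff π g (π l g) y‖ ^ 2 ∂μ ≤ ε := by
      calc _ ≤ ε⁻¹ * ε ^ 2 := by gcongr
        _ = ε := by field_simp
    linarith
  have houtS : ‖∑ l ∈ s, ∫ y in Eᶜ, a l y ∂μ‖ ≤
      (c * C₃ ^ 2 + 1) * ε * s.card + (c * C₃ ^ 2 + c * G2) * s'.card := by
    have hss : s' ⊆ s := fun l hl => (hs l).2 ((hs' l).1 hl).1
    calc _ ≤ ∑ l ∈ s, ‖∫ y in Eᶜ, a l y ∂μ‖ := norm_sum_le _ _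
      _ ≤ ∑ l ∈ s, ((c * C₃ ^ 2 + 1) * ε + if l ∈ s' then c * C₃ ^ 2 + c * G2 else 0) := by
          refine Finset.sum_le_sum fun l hl => ?_
          split_ifs with hl'
          · have := hout1 l hl
            have : 0 ≤ (c * C₃ ^ 2 + 1) * ε := by positivity
            linarith
          · rw [add_zero]; exact hout2 l hl hl'
      _ = _ := by
          rw [Finset.sum_add_distrib, Finset.sum_const, ← Finset.sum_filter,
            Finset.filter_mem_eq_inter, Finset.inter_eq_right.2 hss, Finset.sum_const,
            nsmul_eq_mul, nsmul_eq_mul]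
          ring
  have hre : c * ∑ l ∈ s, (inner ℂ (d l) (π l g)).re - G2 * μ.real E =
      ((c : ℂ) * ∑ l ∈ s, inner ℂ (d l) (π l g) - G2 * μ.real E).re := by
    rw [Complex.sub_re, Complex.re_ofReal_mul, Complex.re_sum, ← Complex.ofReal_mul,
      Complex.ofReal_re]
  rw [hre]
  refine (Complex.abs_re_le_norm _).trans ?_
  rw [hmain]
  refine (norm_sub_le _ _).trans ((add_le_add houtS hrI).trans ?_)
  have e1 : 0 ≤ ε * μ.real E := by positivity
  have e2 : 0 ≤ μ.real (E ∩ (Eᶜ * L)) := by positivity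
  have e3 : 0 ≤ ε * (s.card : ℝ) := by positivity
  have e4 : 0 ≤ (s'.card : ℝ) := by positivity
  have k1 : 0 ≤ (B₁ + B₂) * G2 := by positivity
  have k2 : 0 ≤ B₁ * G2 + 1 := by positivity
  have k3 : 0 ≤ c * C₃ ^ 2 + 1 := by positivity
  have k4 : 0 ≤ c * C₃ ^ 2 + c * G2 := by positivity
  generalize (B₁ + B₂) * G2 = x1 at *
  generalize B₁ * G2 + 1 = x2 at *
  generalize c * C₃ ^ 2 + 1 = x3 at *
  generalize c * C₃ ^ 2 + c * G2 = x4 at *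
  generalize μ.real (E ∩ (Eᶜ * L)) = m2 at *
  generalize (s'.card : ℝ) = n2 at *
  have f1 : x3 * ε * s.card ≤ (x1 + x2 + x3 + x4) * (ε * s.card) := by
    rw [mul_assoc]; gcongr; linarith
  have f2 : x4 * n2 ≤ (x1 + x2 + x3 + x4) * n2 := by gcongr; linarith
  have f3 : x2 * ε * μ.real E ≤ (x1 + x2 + x3 + x4) * (ε * μ.real E) := by
    rw [mul_assoc]; gcongr; linarith
  have f4 : x1 * m2 ≤ (x1 + x2 + x3 + x4) * m2 := by gcongr; linarith
  linarith

end

/-! ### Unimodular counting and densities along Følner sequences -/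

section

variable {G : Type*} [Group G] [TopologicalSpace G] [IsTopologicalGroup G]
  [T2Space G] [LocallyCompactSpace G] [SecondCountableTopology G]
  [MeasurableSpace G] [BorelSpace G] {μ : Measure G} [μ.IsHaarMeasure] {Q Λ : Set G}

set_option linter.unusedSectionVars false

/-- Right invariance makes the inverted measure left invariant, so it is `c • μ`; inverting twice
gives `c² = 1`. -/
theorem isInvInvariant_of_isMulRightInvariant (μ : Measure G) [μ.IsHaarMeasure]
    [μ.IsMulRightInvariant] : μ.IsInvInvariant := by
  constructor
  let c : ℝ≥0∞ := Measure.haarScalarFactor μ.inv μ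
  have hc : μ.inv = c • μ := Measure.isMulLeftInvariant_eq_smul μ.inv μ
  have h1 : (μ.inv).inv = c ^ 2 • μ := by
    rw [hc, Measure.inv_def, Measure.map_smul, ← Measure.inv_def μ, hc, smul_smul, pow_two]
  rw [Measure.inv_inv] at h1
  have K : TopologicalSpace.PositiveCompacts G := Classical.arbitrary _
  have h2 : c ^ 2 * μ K = 1 ^ 2 * μ K := by
    conv_rhs => rw [h1]
    simp
  have h3 : c ^ 2 = 1 ^ 2 :=
    (ENNReal.mul_left_inj (Measure.measure_pos_of_nonempty_interior _ K.interior_nonempty).ne'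
          K.isCompact.measure_lt_top.ne).1 h2
  have h4 : c = 1 := (ENNReal.pow_right_strictMono two_ne_zero).injective h3
  rw [hc, h4, one_smul]

/-- Integral geometric counting formula. -/
theorem lintegral_encard_inter_smul [μ.IsMulRightInvariant] (hΛ : Λ.Countable) (E : Set G)
    {K : Set G} (hK : MeasurableSet K) :
    ∫⁻ y, ((Λ ∩ (E ∩ y • K)).encard : ℝ≥0∞) ∂μ = (Λ ∩ E).encard * μ K := by
  have := hΛ.to_subtype
  have := isInvInvariant_of_isMulRightInvariant μ
  have hind : ∀ l : G, Measurable fun y : G => K.indicator (1 : G → ℝ≥0∞) (y⁻¹ * l) :=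
    fun l => (measurable_one.indicator hK).comp (measurable_inv.mul_const _)
  have h1 : ∀ y, ((Λ ∩ (E ∩ y • K)).encard : ℝ≥0∞) =
      ∑' l : Λ, E.indicator (1 : G → ℝ≥0∞) l * K.indicator 1 (y⁻¹ * l) := by
    intro y
    rw [← tsum_indicator_one_eq_encard]
    refine tsum_congr fun l => ?_
    have h2 : (l : G) ∈ y • K ↔ y⁻¹ * l ∈ K := by
      rw [Set.mem_smul_set_iff_inv_smul_mem, smul_eq_mul]
    by_cases h3 : (l : G) ∈ E <;> by_cases h4 : y⁻¹ * (l : G) ∈ K <;>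
      simp [Set.indicator, h2, h3, h4]
  simp_rw [h1]
  rw [lintegral_tsum fun l : Λ => ((hind (l : G)).const_mul _).aemeasurable, ← tsum_indicator_one_eq_encard,
    ← ENNReal.tsum_mul_right]
  refine tsum_congr fun l => ?_
  rw [lintegral_const_mul _ (hind l), lintegral_inv_eq_self (fun y => K.indicator 1 (y * (l : G))),
    lintegral_mul_right_eq_self (K.indicator 1), lintegral_indicator_one hK]

/-- In the counting formula only `y ∈ EK⁻¹` contribute, each at most `S`. -/
theorem encard_mul_le_of_forall_le [μ.IsMulRightInvariant] (hΛ : Λ.Countable) {E : Set G}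
    (hE : IsCompact E) {K : Set G} (hK : IsCompact K) {S : ℝ≥0∞}
    (hS : ∀ y : G, ((Λ ∩ y • K).encard : ℝ≥0∞) ≤ S) :
    ((Λ ∩ E).encard : ℝ≥0∞) * μ K ≤ S * μ (E * K⁻¹) := by
  rw [← lintegral_encard_inter_smul hΛ E hK.measurableSet]
  have hm : MeasurableSet (E * K⁻¹) := (hE.mul hK.inv).measurableSet
  rw [← setLIntegral_const, ← lintegral_indicator hm]
  refine lintegral_mono fun y => ?_
  by_cases hy : y ∈ E * K⁻¹
  · rw [Set.indicator_of_mem hy]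
    refine le_trans ?_ (hS y)
    exact ENat.toENNReal_mono <| Set.encard_le_encard (Set.inter_subset_inter_right _ Set.inter_subset_right)
  · have h1 : E ∩ y • K = ∅ := by
      refine Set.eq_empty_of_forall_notMem fun l hl => hy ?_
      obtain ⟨k, hk, rfl⟩ := hl.2
      exact ⟨_, hl.1, k⁻¹, Set.inv_mem_inv.2 hk, by simp⟩
    simp [h1]

/-- For `y ∈ E \ EᶜK⁻¹` the window `yK` lies entirely in `E`, so it contributes at least `S`. -/
theorem mul_le_encard_of_forall_le [μ.IsMulRightInvariant] (hΛ : Λ.Countable) {E : Set G}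
    (hE : IsCompact E) {K : Set G} (hK : IsCompact K) {S : ℝ≥0∞}
    (hS : ∀ y : G, S ≤ ((Λ ∩ y • K).encard : ℝ≥0∞)) :
    S * μ (E \ (Eᶜ * K⁻¹)) ≤ ((Λ ∩ E).encard : ℝ≥0∞) * μ K := by
  rw [← lintegral_encard_inter_smul hΛ E hK.measurableSet]
  have hm : MeasurableSet (E \ (Eᶜ * K⁻¹)) :=
    hE.measurableSet.diff hE.isClosed.isOpen_compl.mul_right.measurableSet
  rw [← setLIntegral_const, ← lintegral_indicator hm]
  refine lintegral_mono fun y => ?_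
  by_cases hy : y ∈ E \ (Eᶜ * K⁻¹)
  · rw [Set.indicator_of_mem hy]
    have h1 : E ∩ y • K = y • K := by
      refine Set.inter_eq_right.2 ?_
      rintro _ ⟨k, hk, rfl⟩
      by_contra hcon
      exact hy.2 ⟨_, hcon, k⁻¹, Set.inv_mem_inv.2 hk, by simp⟩
    rw [h1]
    exact hS y
  · rw [Set.indicator_of_notMem hy]; exact zero_le

section Folner

variable {K : ℕ → Set G}

theorem IsStrongFolner.measureReal_pos (hK : IsStrongFolner μ K) (n : ℕ) : 0 < μ.real (K n) :=
  ENNReal.toReal_pos (hK.nonnull n).ne' (hK.isCompact n).measure_lt_top.ne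

theorem eventually_measure_le_of_tendsto_div {u v : ℕ → ℝ≥0∞} (hv : ∀ n, v n ≠ 0)
    (hv' : ∀ n, v n ≠ ∞)
    (h : Tendsto (fun n => u n / v n) atTop (𝓝 0)) {δ : ℝ} (hδ : 0 < δ) :
    ∀ᶠ n in atTop, (u n).toReal ≤ δ * (v n).toReal := by
  filter_upwards [(ENNReal.tendsto_nhds_zero.1 h) (ENNReal.ofReal δ) (ENNReal.ofReal_pos.2 hδ)]
    with n hn
  rw [ENNReal.div_le_iff (hv n) (hv' n)] at hn
  have := ENNReal.toReal_mono (ENNReal.mul_ne_top ENNReal.ofReal_ne_top (hv' n)) hn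
  rwa [ENNReal.toReal_mul, ENNReal.toReal_ofReal hδ.le] at this

theorem IsStrongFolner.eventually_measureReal_mul_le (hK : IsStrongFolner μ K) {L : Set G}
    (hL : IsCompact L) (hne : L.Nonempty) {δ : ℝ} (hδ : 0 < δ) :
    ∀ᶠ n in atTop, μ.real (K n * L) ≤ (1 + δ) * μ.real (K n) := by
  filter_upwards [eventually_measure_le_of_tendsto_div (fun n => (hK.nonnull n).ne')
    (fun n => (hK.isCompact n).measure_lt_top.ne) (hK.folner L hL hne) hδ] with n hn
  have hfin : μ ((K n * L) ∆ K n) ≠ ∞ := by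
    refine ((measure_mono ?_).trans_lt
      (((hK.isCompact n).mul hL).union (hK.isCompact n)).measure_lt_top).ne
    exact symmDiff_le_sup
  have h1 : μ.real (K n * L) ≤ μ.real ((K n * L) ∆ K n ∪ K n) := by
    refine measureReal_mono ?_ (measure_union_ne_top hfin (hK.isCompact n).measure_lt_top.ne)
    intro x hx
    by_cases hxK : x ∈ K n
    · exact .inr hxK
    · exact .inl (.inl ⟨hx, hxK⟩)
  refine h1.trans ((measureReal_union_le _ _).trans ?_)
  change μ.real ((K n * L) ∆ K n) ≤ δ * μ.real (K n) at hn
  linarith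

theorem IsStrongFolner.eventually_boundary_le (hK : IsStrongFolner μ K) {L : Set G}
    (hL : IsCompact L) (hne : L.Nonempty) {δ : ℝ} (hδ : 0 < δ) :
    ∀ᶠ n in atTop, μ.real ((K n * L) ∩ ((K n)ᶜ * L)) ≤ δ * μ.real (K n) :=
  eventually_measure_le_of_tendsto_div (fun n => (hK.nonnull n).ne')
    (fun n => (hK.isCompact n).measure_lt_top.ne) (hK.strong L hL hne) hδ

theorem IsStrongFolner.nonempty (hK : IsStrongFolner μ K) (n : ℕ) : (K n).Nonempty :=
  nonempty_of_measure_ne_zero (hK.nonnull n).ne'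

/-- The density of `Λ` in `x • K`. -/
noncomputable def pointDensity (μ : Measure G) (Λ K : Set G) (x : G) : ℝ :=
  ((Λ ∩ x • K).ncard : ℝ) / μ.real K

/-- Every translate of a compact set contains a uniformly bounded number of points of `Λ`. -/
def IsUniformlyLocallyFinite (Λ : Set G) : Prop :=
  ∀ K : Set G, IsCompact K → ∃ N : ℕ, ∀ x : G, (Λ ∩ x • K).encard ≤ N

theorem IsUniformlyLocallyFinite.finite (h : IsUniformlyLocallyFinite Λ) {K : Set G}
    (hK : IsCompact K) : (Λ ∩ K).Finite := by
  obtain ⟨N, hN⟩ := h K hK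
  have := hN 1
  rw [one_smul] at this
  exact Set.finite_of_encard_le_coe this

theorem IsUniformlyLocallyFinite.encard_eq (h : IsUniformlyLocallyFinite Λ) {K : Set G}
    (hK : IsCompact K) : ((Λ ∩ K).encard : ℝ≥0∞) = ENNReal.ofReal ((Λ ∩ K).ncard : ℝ) := by
  rw [← (h.finite hK).cast_ncard_eq]
  simp

theorem pointDensity_nonneg (K : Set G) (x : G) : 0 ≤ pointDensity μ Λ K x := by
  unfold pointDensity; positivity

theorem IsUniformlyLocallyFinite.bddAbove (h : IsUniformlyLocallyFinite Λ) {K : Set G}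
    (hK : IsCompact K) : BddAbove (Set.range (pointDensity μ Λ K)) := by
  obtain ⟨N, hN⟩ := h K hK
  refine ⟨N / μ.real K, ?_⟩
  rintro _ ⟨x, rfl⟩
  unfold pointDensity
  gcongr
  have h1 := hN x
  rw [← (h.finite (hK.smul x)).cast_ncard_eq] at h1
  exact_mod_cast h1

theorem bddBelow_pointDensity (K : Set G) : BddBelow (Set.range (pointDensity μ Λ K)) :=
  ⟨0, by rintro _ ⟨x, rfl⟩; exact pointDensity_nonneg K x⟩

theorem smul_sdiff_boundary (x : G) (E L : Set G) :
    (x • E) \ ((x • E)ᶜ * L) = x • (E \ (Eᶜ * L)) := by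
  rw [← Set.smul_set_compl, smul_mul_assoc, Set.smul_set_sdiff]

theorem IsUniformlyLocallyFinite.ncard_mul_le [μ.IsMulRightInvariant]
    (h : IsUniformlyLocallyFinite Λ) (hΛ : Λ.Countable)
    {E : Set G} (hE : IsCompact E) {K : Set G} (hK : IsCompact K) {S : ℝ} (hS0 : 0 ≤ S)
    (hS : ∀ y : G, ((Λ ∩ y • K).ncard : ℝ) ≤ S) :
    ((Λ ∩ E).ncard : ℝ) * μ.real K ≤ S * μ.real (E * K⁻¹) := by
  have h1 := encard_mul_le_of_forall_le (μ := μ) hΛ hE hK (S := ENNReal.ofReal S) fun y => by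
    rw [h.encard_eq (hK.smul y)]
    exact ENNReal.ofReal_le_ofReal (hS y)
  have h2 := ENNReal.toReal_mono (ENNReal.mul_ne_top ENNReal.ofReal_ne_top
    (hE.mul hK.inv).measure_lt_top.ne) h1
  rwa [h.encard_eq hE, ENNReal.toReal_mul, ENNReal.toReal_mul, ENNReal.toReal_ofReal hS0,
    ENNReal.toReal_ofReal (by positivity)] at h2

theorem IsUniformlyLocallyFinite.mul_le_ncard [μ.IsMulRightInvariant]
    (h : IsUniformlyLocallyFinite Λ) (hΛ : Λ.Countable)
    {E : Set G} (hE : IsCompact E) {K : Set G} (hK : IsCompact K) {S : ℝ} (hS0 : 0 ≤ S)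
    (hS : ∀ y : G, S ≤ ((Λ ∩ y • K).ncard : ℝ)) :
    S * μ.real (E \ (Eᶜ * K⁻¹)) ≤ ((Λ ∩ E).ncard : ℝ) * μ.real K := by
  have h1 := mul_le_encard_of_forall_le (μ := μ) hΛ hE hK (S := ENNReal.ofReal S) fun y => by
    rw [h.encard_eq (hK.smul y)]
    exact ENNReal.ofReal_le_ofReal (hS y)
  rw [h.encard_eq hE] at h1
  have h2 := ENNReal.toReal_mono (ENNReal.mul_ne_top ENNReal.ofReal_ne_top
    hK.measure_lt_top.ne) h1
  rwa [ENNReal.toReal_mul, ENNReal.toReal_mul, ENNReal.toReal_ofReal hS0,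
    ENNReal.toReal_ofReal (by positivity)] at h2

/-- The window `K'` bounds the count in `xK_n` by its largest density times `μ(K_n K'⁻¹)`, and the
Følner condition makes this close to `μ(K_n)`. -/
theorem eventually_iSup_pointDensity_le [μ.IsMulRightInvariant]
    (h : IsUniformlyLocallyFinite Λ) (hΛ : Λ.Countable)
    (hK : IsStrongFolner μ K) {K' : Set G} (hK' : IsCompact K') (hK'0 : 0 < μ.real K')
    {ε : ℝ} (hε : 0 < ε) :
    ∀ᶠ n in atTop, ⨆ x, pointDensity μ Λ (K n) x ≤ (⨆ x, pointDensity μ Λ K' x) + ε := by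
  set S := ⨆ x, pointDensity μ Λ K' x with hSdef
  have hS0 : 0 ≤ S := Real.iSup_nonneg fun x => pointDensity_nonneg K' x
  have hS : ∀ y : G, ((Λ ∩ y • K').ncard : ℝ) ≤ S * μ.real K' := fun y =>
    (div_le_iff₀ hK'0).1 (le_ciSup (h.bddAbove hK') y)
  have hne : (K'⁻¹).Nonempty := by
    refine Set.Nonempty.inv (nonempty_of_measure_ne_zero (μ := μ) fun h0 => ?_)
    simp [Measure.real, h0] at hK'0
  filter_upwards [hK.eventually_measureReal_mul_le hK'.inv hne
    (δ := ε / (S + 1)) (by positivity)] with n hn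
  refine ciSup_le fun x => ?_
  have h1 := h.ncard_mul_le (μ := μ) hΛ ((hK.isCompact n).smul x) hK'
    (mul_nonneg hS0 hK'0.le) hS
  rw [smul_mul_assoc, measureReal_def, measureReal_def μ (x • _), measure_smul,
    ← measureReal_def, ← measureReal_def] at h1
  have hn0 := hK.measureReal_pos n
  rw [pointDensity, div_le_iff₀ hn0]
  have h2 : ((Λ ∩ x • K n).ncard : ℝ) ≤ S * μ.real (K n * K'⁻¹) := by
    refine le_of_mul_le_mul_right ?_ hK'0
    linarith
  have h3 : S * (ε / (S + 1)) ≤ ε := by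
    rw [mul_div_assoc', div_le_iff₀ (by positivity)]
    nlinarith
  calc _ ≤ S * μ.real (K n * K'⁻¹) := h2
    _ ≤ S * ((1 + ε / (S + 1)) * μ.real (K n)) := by gcongr
    _ = (S + S * (ε / (S + 1))) * μ.real (K n) := by ring
    _ ≤ (S + ε) * μ.real (K n) := by gcongr

theorem eventually_le_iInf_pointDensity [μ.IsMulRightInvariant]
    (h : IsUniformlyLocallyFinite Λ) (hΛ : Λ.Countable)
    (hK : IsStrongFolner μ K) {K' : Set G} (hK' : IsCompact K') (hK'0 : 0 < μ.real K')
    {ε : ℝ} (hε : 0 < ε) :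
    ∀ᶠ n in atTop, (⨅ x, pointDensity μ Λ K' x) - ε ≤ ⨅ x, pointDensity μ Λ (K n) x := by
  set S := ⨅ x, pointDensity μ Λ K' x with hSdef
  have hS0 : 0 ≤ S := Real.iInf_nonneg fun x => pointDensity_nonneg K' x
  have hS : ∀ y : G, S * μ.real K' ≤ ((Λ ∩ y • K').ncard : ℝ) := fun y =>
    (le_div_iff₀ hK'0).1 (ciInf_le (bddBelow_pointDensity K') y)
  -- Adjoining `1` puts `K n` inside `K n * L`, so the strong condition controls the part of `K n`
  -- lost near its boundary.
  have hL : IsCompact (insert 1 K'⁻¹) := hK'.inv.insert 1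
  filter_upwards [hK.eventually_boundary_le hL (Set.insert_nonempty _ _)
    (δ := ε / (S + 1)) (by positivity)] with n hn
  refine le_ciInf fun x => ?_
  have h1 := h.mul_le_ncard (μ := μ) hΛ ((hK.isCompact n).smul x) hK'
    (mul_nonneg hS0 hK'0.le) hS
  rw [smul_sdiff_boundary, measureReal_def, measureReal_def μ (x • _), measure_smul,
    ← measureReal_def, ← measureReal_def] at h1
  have hn0 := hK.measureReal_pos n
  rw [pointDensity, le_div_iff₀ hn0]
  have h2 : S * μ.real (K n \ ((K n)ᶜ * K'⁻¹)) ≤ ((Λ ∩ x • K n).ncard : ℝ) := by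
    refine le_of_mul_le_mul_right ?_ hK'0
    linarith
  have h3 : S * (ε / (S + 1)) ≤ ε := by
    rw [mul_div_assoc', div_le_iff₀ (by positivity)]
    nlinarith
  have h4 : μ.real (K n) ≤ μ.real (K n \ ((K n)ᶜ * K'⁻¹)) +
      μ.real ((K n * insert 1 K'⁻¹) ∩ ((K n)ᶜ * insert 1 K'⁻¹)) := by
    refine (measureReal_mono (fun y hy => ?_) ?_).trans (measureReal_union_le _ _)
    · by_cases hyL : y ∈ (K n)ᶜ * K'⁻¹
      · exact .inr ⟨⟨y, hy, 1, Set.mem_insert _ _, mul_one y⟩,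
          Set.mul_subset_mul_left (Set.subset_insert _ _) hyL⟩
      · exact .inl ⟨hy, hyL⟩
    · refine measure_union_ne_top ?_ ?_
      · exact ((measure_mono Set.sdiff_subset).trans_lt (hK.isCompact n).measure_lt_top).ne
      · exact ((measure_mono Set.inter_subset_left).trans_lt
          ((hK.isCompact n).mul hL).measure_lt_top).ne
  have h5 : S * μ.real (K n) ≤ S * (μ.real (K n \ ((K n)ᶜ * K'⁻¹)) +
      ε / (S + 1) * μ.real (K n)) := by
    gcongr
    linarith
  have h6 : S * (ε / (S + 1)) * μ.real (K n) ≤ ε * μ.real (K n) := by gcongr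
  linarith

end Folner

end

/-! ### Common limits and extrema -/

/-- Sequences which are pairwise asymptotically dominated by single terms of each other converge
to a common limit. -/
theorem exists_common_limit (P : (ℕ → ℝ) → Prop)
    (hb : ∀ u, P u → ∃ b, ∀ᶠ n in atTop, b ≤ u n)
    (h : ∀ u v, P u → P v → ∀ m : ℕ, ∀ ε : ℝ, 0 < ε → ∀ᶠ n in atTop, u n ≤ v m + ε) :
    ∃ D : ℝ, ∀ u, P u → Tendsto u atTop (𝓝 D) := by
  by_cases hP : ∃ u, P u
  swap
  · exact ⟨0, fun u hu => (hP ⟨u, hu⟩).elim⟩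
  obtain ⟨u₀, hu₀⟩ := hP
  obtain ⟨b, hb⟩ := hb u₀ hu₀
  -- The limit is the infimum of all values of all admissible sequences: no term lies below it, and
  -- a single nearly minimal term eventually dominates every sequence up to `ε`.
  let A : Set ℝ := {r | ∃ v m, P v ∧ v m = r}
  have hA : BddBelow A := by
    refine ⟨b - 1, ?_⟩
    rintro _ ⟨v, m, hv, rfl⟩
    obtain ⟨n, hn1, hn2⟩ := (hb.and (h u₀ v hu₀ hv m 1 one_pos)).exists
    linarith
  have hne : A.Nonempty := ⟨_, u₀, 0, hu₀, rfl⟩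
  refine ⟨sInf A, fun u hu => Metric.tendsto_nhds.2 fun ε hε => ?_⟩
  obtain ⟨_, ⟨v, m, hv, rfl⟩, hvm⟩ := exists_lt_of_csInf_lt hne (lt_add_of_pos_right (sInf A)
    (half_pos hε))
  filter_upwards [h u v hu hv m (ε / 4) (by positivity)] with n hn
  have h1 : sInf A ≤ u n := csInf_le hA ⟨u, n, hu, rfl⟩
  rw [Real.dist_eq, abs_lt]
  constructor <;> linarith

theorem abs_iInf_sub_iInf_le {ι : Type*} [Nonempty ι] {a b : ι → ℝ} {ε : ℝ}
    (ha : BddBelow (Set.range a)) (hb : BddBelow (Set.range b)) (h : ∀ x, |a x - b x| ≤ ε) :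
    |(⨅ x, a x) - ⨅ x, b x| ≤ ε := by
  rw [abs_sub_le_iff]
  constructor
  · have : (⨅ x, a x) - ε ≤ ⨅ x, b x := le_ciInf fun x => by
      have h1 := ciInf_le ha x
      have h2 := (abs_sub_le_iff.1 (h x)).1
      linarith
    linarith
  · have : (⨅ x, b x) - ε ≤ ⨅ x, a x := le_ciInf fun x => by
      have h1 := ciInf_le hb x
      have h2 := (abs_sub_le_iff.1 (h x)).2
      linarith
    linarith

theorem abs_iSup_sub_iSup_le {ι : Type*} [Nonempty ι] {a b : ι → ℝ} {ε : ℝ}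
    (ha : BddAbove (Set.range a)) (hb : BddAbove (Set.range b)) (h : ∀ x, |a x - b x| ≤ ε) :
    |(⨆ x, a x) - ⨆ x, b x| ≤ ε := by
  rw [abs_sub_le_iff]
  constructor
  · have : (⨆ x, a x) ≤ (⨆ x, b x) + ε := ciSup_le fun x => by
      have h1 := le_ciSup hb x
      have h2 := (abs_sub_le_iff.1 (h x)).1
      linarith
    linarith
  · have : (⨆ x, b x) ≤ (⨆ x, a x) + ε := ciSup_le fun x => by
      have h1 := le_ciSup ha x
      have h2 := (abs_sub_le_iff.1 (h x)).2
      linarith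
    linarith

theorem iInf_const_div {ι : Type*} [Nonempty ι] {r : ι → ℝ} {d D : ℝ} (hd : 0 < d) (hD : 0 < D)
    (hr : ∀ x, d ≤ r x) (hb : BddAbove (Set.range r)) : ⨅ x, D / r x = D / ⨆ x, r x := by
  obtain ⟨x₀⟩ := ‹Nonempty ι›
  have : Nonempty ι := ⟨x₀⟩
  have hbb : BddBelow (Set.range fun x => D / r x) :=
    ⟨0, by rintro _ ⟨x, rfl⟩; exact div_nonneg hD.le (hd.le.trans (hr x))⟩
  have hS : 0 < ⨆ x, r x := hd.trans_le ((hr x₀).trans (le_ciSup hb x₀))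
  refine le_antisymm ?_ (le_ciInf fun x => ?_)
  · rw [le_div_iff₀ hS, mul_comm, ← le_div_iff₀]
    · refine ciSup_le fun x => ?_
      rw [le_div_iff₀, mul_comm, ← le_div_iff₀ (hd.trans_le (hr x))]
      · exact ciInf_le hbb x
      · refine lt_of_lt_of_le (div_pos hD hS) (le_ciInf fun y => ?_)
        exact div_le_div_of_nonneg_left hD.le (hd.trans_le (hr y)) (le_ciSup hb y)
    · refine lt_of_lt_of_le (div_pos hD hS) (le_ciInf fun y => ?_)
      exact div_le_div_of_nonneg_left hD.le (hd.trans_le (hr y)) (le_ciSup hb y)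
  · exact div_le_div_of_nonneg_left hD.le (hd.trans_le (hr x)) (le_ciSup hb x)

theorem iSup_const_div {ι : Type*} [Nonempty ι] {r : ι → ℝ} {d D : ℝ} (hd : 0 < d) (hD : 0 < D)
    (hr : ∀ x, d ≤ r x) : ⨆ x, D / r x = D / ⨅ x, r x := by
  have hbb : BddBelow (Set.range r) := ⟨d, by rintro _ ⟨x, rfl⟩; exact hr x⟩
  have hI : 0 < ⨅ x, r x := hd.trans_le (le_ciInf hr)
  have hle : ∀ x, D / r x ≤ D / ⨅ x, r x := fun x =>
    div_le_div_of_nonneg_left hD.le hI (ciInf_le hbb x)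
  have hba : BddAbove (Set.range fun x => D / r x) := ⟨_, by rintro _ ⟨x, rfl⟩; exact hle x⟩
  refine le_antisymm (ciSup_le hle) ?_
  obtain ⟨x₀⟩ := ‹Nonempty ι›
  have : Nonempty ι := ⟨x₀⟩
  have hS : 0 < ⨆ x, D / r x :=
    (div_pos hD (hd.trans_le (hr x₀))).trans_le (le_ciSup hba x₀)
  rw [div_le_iff₀ hI, mul_comm, ← div_le_iff₀ hS]
  refine le_ciInf fun x => ?_
  rw [div_le_iff₀ hS, mul_comm, ← div_le_iff₀ (hd.trans_le (hr x))]
  exact le_ciSup hba x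

theorem exists_finset_inter {G : Type*} {Λ E : Set G} (h : (Λ ∩ E).Finite) :
    ∃ s : Finset Λ, (∀ l, l ∈ s ↔ (l : G) ∈ E) ∧ s.card = (Λ ∩ E).ncard ∧
      ∀ f : G → ℝ, ∑ᶠ l ∈ Λ ∩ E, f l = ∑ l ∈ s, f l := by
  have hfin : {l : Λ | (l : G) ∈ E}.Finite := by
    refine Set.Finite.of_finite_image (f := Subtype.val) (h.subset ?_)
      Subtype.val_injective.injOn
    rintro _ ⟨l, hl, rfl⟩
    exact ⟨l.2, hl⟩
  have hcoe : ((hfin.toFinset.map ⟨Subtype.val, Subtype.val_injective⟩ : Finset G) : Set G) =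
      Λ ∩ E := by
    ext x
    simp [and_comm]
  refine ⟨hfin.toFinset, fun l => by simp, ?_, fun f => ?_⟩
  · rw [← hcoe, Set.ncard_coe_finset, Finset.card_map]
  · rw [← hcoe, finsum_mem_coe_finset, Finset.sum_map]
    rfl

/-! ### Uniform trace asymptotics along a Følner sequence -/

section

variable {G : Type*} [Group G] [TopologicalSpace G] [IsTopologicalGroup G]
  [T2Space G] [LocallyCompactSpace G] [SecondCountableTopology G]
  [MeasurableSpace G] [BorelSpace G] {μ : Measure G} [μ.IsHaarMeasure]
  {Q Λ : Set G} {K : ℕ → Set G}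

set_option linter.unusedSectionVars false

theorem ncard_mul_measureReal_le (hQc : IsCompact Q) (hQs : Q⁻¹ = Q) (hΛ : Λ.Countable) {N : ℕ}
    (hN : ∀ x : G, (Λ ∩ x • Q).encard ≤ N) {A : Set G} (hA : (Λ ∩ A).Finite)
    (hAQ : μ (A * Q) ≠ ∞) : ((Λ ∩ A).ncard : ℝ) * μ.real Q ≤ N * μ.real (A * Q) := by
  have h1 := encard_mul_measure_le (μ := μ) hQc hQs hΛ hN A
  rw [← hA.cast_ncard_eq] at h1
  have h2 := ENNReal.toReal_mono (ENNReal.mul_ne_top (ENNReal.natCast_ne_top N) hAQ) h1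
  simpa [ENNReal.toReal_mul, Measure.real] using h2

theorem IsStrongFolner.exists_ncard_le (hK : IsStrongFolner μ K) (hΛ : Λ.Countable)
    (h : IsUniformlyLocallyFinite Λ) (hQc : IsCompact Q) (hQs : Q⁻¹ = Q) (hQ : Q ∈ 𝓝 (1 : G)) :
    ∃ C : ℝ, ∀ᶠ n in atTop, ∀ x : G, ((Λ ∩ x • K n).ncard : ℝ) ≤ C * μ.real (K n) := by
  obtain ⟨N, hN⟩ := h Q hQc
  have hQ0 : 0 < μ.real Q :=
    ENNReal.toReal_pos (Measure.measure_pos_of_mem_nhds μ hQ).ne' hQc.measure_lt_top.ne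
  refine ⟨N * 2 / μ.real Q, ?_⟩
  filter_upwards [hK.eventually_measureReal_mul_le hQc ⟨1, mem_of_mem_nhds hQ⟩ one_pos] with n hn x
  have h1 := ncard_mul_measureReal_le (μ := μ) hQc hQs hΛ hN
    (h.finite ((hK.isCompact n).smul x))
    ((((hK.isCompact n).smul x).mul hQc).measure_lt_top.ne)
  rw [smul_mul_assoc, measureReal_def μ (x • _), measure_smul, ← measureReal_def] at h1
  rw [div_mul_eq_mul_div, le_div_iff₀ hQ0]
  have h2 : (N : ℝ) * μ.real (K n * Q) ≤ N * ((1 + 1) * μ.real (K n)) := by gcongr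
  linarith

variable {H : Type*} [NormedAddCommGroup H] [InnerProductSpace ℂ H] [CompleteSpace H]
  {π : G → H ≃ₗᵢ[ℂ] H} {g : H}

/-- The upper frame bound at `f = π(y)g` bounds the square sums of samples of `V_g g` over all
`l⁻¹y`, uniformly in `y`; a non-zero function allows this only for uniformly sparse sets. -/
theorem IsCoherentFrame.isUniformlyLocallyFinite (hπ : IsProjectiveRep π) {c : ℝ}
    (hc : ∀ f, MemLp (coeff π g f) 2 μ ∧ ∫ y, ‖coeff π g f y‖ ^ 2 ∂μ = c * ‖f‖ ^ 2)
    (hc0 : 0 < c) (hg : g ≠ 0) (hΛ : Λ.Countable) (hF : IsCoherentFrame π g Λ) :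
    IsUniformlyLocallyFinite Λ := by
  obtain ⟨A, B, -, hB, hfr⟩ := hF
  intro K hK
  have hint : ∫⁻ y, ‖coeff π g g y‖ₑ ^ 2 ∂μ = ENNReal.ofReal (c * ‖g‖ ^ 2) := by
    rw [← (hc g).2, ofReal_integral_eq_lintegral_ofReal
      ((memLp_two_iff_integrable_sq_norm (hc g).1.1).1 (hc g).1)
      (ae_of_all _ fun y => by positivity)]
    simp_rw [sq_enorm_eq_ofReal]
  refine exists_encard_inter_smul_le (μ := μ) hΛ (hπ.stronglyMeasurable_coeff g g) ?_ ?_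
    (B := ENNReal.ofReal (B * ‖g‖ ^ 2)) ENNReal.ofReal_ne_top (fun y => ?_) hK
  · rw [hint]
    exact (ENNReal.ofReal_pos.2 (by positivity)).ne'
  · rw [hint]
    exact ENNReal.ofReal_ne_top
  · have h1 := hfr (π y g)
    rw [LinearIsometryEquiv.norm_map] at h1
    simp_rw [sq_enorm_eq_ofReal, ← norm_coeff_apply_swap hπ]
    rw [← ENNReal.ofReal_tsum_of_nonneg (fun _ => by positivity) h1.1]
    exact ENNReal.ofReal_le_ofReal h1.2.2

/-- Along a strong Følner sequence, the partial traces of the frame expansion are uniformly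
asymptotic to the formal dimension times the volume. -/
theorem eventually_abs_finsum_sub_le (hQc : IsCompact Q) (hQs : Q⁻¹ = Q)
    (hQ : Q ∈ 𝓝 (1 : G)) [μ.IsMulRightInvariant] (hπ : IsProjectiveRep π) {c : ℝ}
    (hc : ∀ f, MemLp (coeff π g f) 2 μ ∧ ∫ y, ‖coeff π g f y‖ ^ 2 ∂μ = c * ‖f‖ ^ 2)
    (hc0 : 0 < c) (hgB : g ∈ B2 μ Q π) (hΛ : Λ.Countable)
    (h : IsUniformlyLocallyFinite Λ) (hF : IsCoherentFrame π g Λ) (hK : IsStrongFolner μ K)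
    {ε : ℝ} (hε : 0 < ε) :
    ∀ᶠ n in atTop, ∀ x : G,
      |(∑ᶠ l ∈ Λ ∩ x • K n, (inner ℂ (canonicalDual π g Λ l) (π l g)).re) -
        ‖g‖ ^ 2 / c * μ.real (K n)| ≤ ε * μ.real (K n) := by
  obtain ⟨N, hN⟩ := h Q hQc
  have hQ0 : 0 < μ.real Q :=
    ENNReal.toReal_pos (Measure.measure_pos_of_mem_nhds μ hQ).ne' hQc.measure_lt_top.ne
  have hQ1 : (1 : G) ∈ Q := mem_of_mem_nhds hQ
  obtain ⟨C₀, hC₀⟩ := hK.exists_ncard_le hΛ h hQc hQs hQ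
  obtain ⟨C, hC, hest⟩ := exists_trace_estimate hπ hc hc0 hF fun ε hε =>
    exists_isCompact_tail_le hQc hQs hQ (hπ.stronglyMeasurable_coeff g g) hgB hΛ hN hε
  set q := (N : ℝ) / μ.real Q with hq
  have hq0 : 0 ≤ q := by positivity
  -- The four error terms are at most `1`, `1`, `|C₀|` and `q` times `t μ(K_n)`.
  set t := c * ε / (C * (2 + |C₀| + q)) with ht
  have ht0 : 0 < t := by positivity
  obtain ⟨L, hL, h1L, hest⟩ := hest t ht0
  -- Using `L * Q` controls both the boundary and its `Q`-thickening, whose measure bounds the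
  -- number of boundary points.
  filter_upwards [hC₀, hK.eventually_boundary_le (hL.mul hQc)
    ⟨1 * 1, Set.mul_mem_mul h1L hQ1⟩ ht0] with n hn1 hn2 x
  have hE : IsCompact (x • K n) := (hK.isCompact n).smul x
  have hm0 := hK.measureReal_pos n
  obtain ⟨s, hs, hscard, hsum⟩ := exists_finset_inter (h.finite hE)
  obtain ⟨s', hs', hscard', -⟩ := exists_finset_inter (Λ := Λ)
    (E := (x • K n) ∩ ((x • K n)ᶜ * L)) ((h.finite hE).subset
      (Set.inter_subset_inter_right _ Set.inter_subset_left))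
  have hbd := hest (x • K n) hE s hs s' hs'
  rw [hsum]
  have hbdry : (x • K n) ∩ ((x • K n)ᶜ * L) = x • (K n ∩ ((K n)ᶜ * L)) := by
    rw [← Set.smul_set_compl, smul_mul_assoc, Set.smul_set_inter]
  have hKL : K n * (L * Q) ∩ ((K n)ᶜ * (L * Q)) ⊆ K n * (L * Q) := Set.inter_subset_left
  have hfin : μ (K n * (L * Q) ∩ ((K n)ᶜ * (L * Q))) ≠ ∞ :=
    ((measure_mono hKL).trans_lt ((hK.isCompact n).mul (hL.mul hQc)).measure_lt_top).ne
  have hsub1 : K n ∩ ((K n)ᶜ * L) ⊆ K n * (L * Q) ∩ ((K n)ᶜ * (L * Q)) := by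
    rintro y ⟨hy1, z, hz, l, hl, rfl⟩
    exact ⟨⟨_, hy1, 1, ⟨1, h1L, 1, hQ1, by simp⟩, by simp⟩,
      ⟨z, hz, l, ⟨l, hl, 1, hQ1, by simp⟩, rfl⟩⟩
  have hsub2 : (K n ∩ ((K n)ᶜ * L)) * Q ⊆ K n * (L * Q) ∩ ((K n)ᶜ * (L * Q)) := by
    rintro _ ⟨_, ⟨hy1, z, hz, l, hl, rfl⟩, q, hq, rfl⟩
    exact ⟨⟨_, hy1, q, ⟨1, h1L, q, hq, by simp⟩, rfl⟩,
      ⟨z, hz, l * q, ⟨l, hl, q, hq, rfl⟩, by simp [mul_assoc]⟩⟩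
  have hE1 : μ.real (x • K n) = μ.real (K n) := by
    rw [measureReal_def, measure_smul, ← measureReal_def]
  have hE2 : μ.real ((x • K n) ∩ ((x • K n)ᶜ * L)) ≤ t * μ.real (K n) := by
    rw [hbdry, measureReal_def, measure_smul, ← measureReal_def]
    exact (measureReal_mono hsub1 hfin).trans hn2
  have hE3 : (s.card : ℝ) ≤ |C₀| * μ.real (K n) := by
    rw [hscard]
    refine (hn1 x).trans ?_
    gcongr
    exact le_abs_self _
  have hE4 : (s'.card : ℝ) ≤ q * (t * μ.real (K n)) := by
    have hmeas : μ (((x • K n) ∩ ((x • K n)ᶜ * L)) * Q) =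
        μ ((K n ∩ ((K n)ᶜ * L)) * Q) := by
      rw [hbdry, smul_mul_assoc, measure_smul]
    have h1 := ncard_mul_measureReal_le (μ := μ) hQc hQs hΛ hN
      (A := (x • K n) ∩ ((x • K n)ᶜ * L)) ((h.finite hE).subset
      (Set.inter_subset_inter_right _ Set.inter_subset_left))
      (by rw [hmeas]; exact ((measure_mono hsub2).trans_lt hfin.lt_top).ne)
    rw [measureReal_def μ (_ * Q), hmeas, ← measureReal_def, ← hscard'] at h1
    have h2 := (measureReal_mono hsub2 hfin).trans hn2
    rw [hq, div_mul_eq_mul_div, le_div_iff₀ hQ0]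
    exact h1.trans (by gcongr)
  rw [hE1] at hbd
  set m := μ.real (K n)
  set S := ∑ l ∈ s, (inner ℂ (canonicalDual π g Λ l) (π l g)).re
  have h3 : C * (t * m + μ.real ((x • K n) ∩ ((x • K n)ᶜ * L)) + t * s.card + s'.card) ≤
      c * ε * m := by
    calc _ ≤ C * (t * m + t * m + t * (|C₀| * m) + q * (t * m)) := by gcongr
      _ = t * (C * (2 + |C₀| + q)) * m := by ring
      _ = c * ε * m := by rw [ht, div_mul_cancel₀ _ (by positivity)]
  have h4 : c * S - ‖g‖ ^ 2 * m = c * (S - ‖g‖ ^ 2 / c * m) := by field_simp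
  rw [h4, abs_mul, abs_of_pos hc0] at hbd
  have h5 := hbd.trans h3
  rw [mul_assoc] at h5
  exact le_of_mul_le_mul_left h5 hc0

end

section

variable {G H : Type*} [NormedAddCommGroup H] [InnerProductSpace ℂ H]
  {π : G → H ≃ₗᵢ[ℂ] H} {g : H} {Λ : Set G}

theorem frameAverage_mem_Icc {E : Set G} (hE : (Λ ∩ E).Finite)
    (h01 : ∀ l ∈ Λ, 0 ≤ (inner ℂ (canonicalDual π g Λ l) (π l g)).re ∧
      (inner ℂ (canonicalDual π g Λ l) (π l g)).re ≤ 1) :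
    0 ≤ frameAverage π g Λ E ∧ frameAverage π g Λ E ≤ 1 ∧
      ∑ᶠ l ∈ Λ ∩ E, (inner ℂ (canonicalDual π g Λ l) (π l g)).re ≤ (Λ ∩ E).ncard := by
  obtain ⟨s, -, hcard, hsum⟩ := exists_finset_inter hE
  rw [frameAverage, hsum, ← hcard]
  have h0 : 0 ≤ ∑ l ∈ s, (inner ℂ (canonicalDual π g Λ l) (π l g)).re :=
    Finset.sum_nonneg fun l _ => (h01 l l.2).1
  have h1 : ∑ l ∈ s, (inner ℂ (canonicalDual π g Λ l) (π l g)).re ≤ s.card := by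
    simpa using Finset.sum_le_card_nsmul s _ 1 fun l _ => (h01 l l.2).2
  refine ⟨by positivity, ?_, h1⟩
  rw [inv_mul_eq_div]
  exact div_le_one_of_le₀ h1 (by positivity)

end

/-! ### From densities to frame measures -/

section

variable {G : Type*} [Group G] [TopologicalSpace G] [IsTopologicalGroup G]
  [T2Space G] [LocallyCompactSpace G] [SecondCountableTopology G]
  [MeasurableSpace G] [BorelSpace G] {μ : Measure G} [μ.IsHaarMeasure]
  {Q Λ : Set G} {K : ℕ → Set G}

/-- The upper density along a strong Følner sequence does not depend on the sequence. -/
theorem exists_upper_density [μ.IsMulRightInvariant] (h : IsUniformlyLocallyFinite Λ)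
    (hΛ : Λ.Countable) :
    ∃ D : ℝ, ∀ K : ℕ → Set G, IsStrongFolner μ K →
      Tendsto (fun n => ⨆ x, pointDensity μ Λ (K n) x) atTop (𝓝 D) := by
  obtain ⟨D, hD⟩ := exists_common_limit
    (fun u => ∃ K : ℕ → Set G, IsStrongFolner μ K ∧ u = fun n => ⨆ x, pointDensity μ Λ (K n) x)
    (by
      rintro _ ⟨K, hK, rfl⟩
      exact ⟨0, Eventually.of_forall fun n =>
        Real.iSup_nonneg fun x => pointDensity_nonneg (K n) x⟩)
    (by
      rintro _ _ ⟨K, hK, rfl⟩ ⟨K', hK', rfl⟩ m ε hε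
      exact eventually_iSup_pointDensity_le h hΛ hK (hK'.isCompact m) (hK'.measureReal_pos m) hε)
  exact ⟨D, fun K hK => hD _ ⟨K, hK, rfl⟩⟩

/-- The lower density along a strong Følner sequence does not depend on the sequence. -/
theorem exists_lower_density [μ.IsMulRightInvariant] (h : IsUniformlyLocallyFinite Λ)
    (hΛ : Λ.Countable) (hQc : IsCompact Q) (hQs : Q⁻¹ = Q) (hQ : Q ∈ 𝓝 (1 : G)) :
    ∃ D : ℝ, ∀ K : ℕ → Set G, IsStrongFolner μ K →
      Tendsto (fun n => ⨅ x, pointDensity μ Λ (K n) x) atTop (𝓝 D) := by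
  obtain ⟨D, hD⟩ := exists_common_limit
    -- Negation turns domination from below into the form required; the packing bound then supplies
    -- the lower bound on the negated sequence.
    (fun u => ∃ K : ℕ → Set G, IsStrongFolner μ K ∧
      u = fun n => -⨅ x, pointDensity μ Λ (K n) x)
    (by
      rintro _ ⟨K, hK, rfl⟩
      obtain ⟨C, hC⟩ := hK.exists_ncard_le hΛ h hQc hQs hQ
      refine ⟨-C, ?_⟩
      filter_upwards [hC] with n hn
      refine neg_le_neg ((ciInf_le (bddBelow_pointDensity (K n)) 1).trans ?_)
      exact (div_le_iff₀ (hK.measureReal_pos n)).2 (hn 1))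
    (by
      rintro _ _ ⟨K, hK, rfl⟩ ⟨K', hK', rfl⟩ m ε hε
      filter_upwards [eventually_le_iInf_pointDensity h hΛ hK (hK'.isCompact m)
        (hK'.measureReal_pos m) hε] with n hn
      linarith)
  refine ⟨-D, fun K hK => ?_⟩
  have h1 := (hD _ ⟨K, hK, rfl⟩).neg
  simpa using h1

variable {H : Type*} [NormedAddCommGroup H] [InnerProductSpace ℂ H]
  {π : G → H ≃ₗᵢ[ℂ] H} {g : H}

/-- If the partial traces are asymptotic to `D` times the volume, then the frame averages are
asymptotic to `D` divided by the point density. -/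
theorem abs_frameAverage_sub_le (hK : IsStrongFolner μ K) {D ε : ℝ} (hD : 0 < D)
    (hεD : ε ≤ D / 2) {n : ℕ} {x : G} (hfin : (Λ ∩ x • K n).Finite)
    (h01 : ∀ l ∈ Λ, 0 ≤ (inner ℂ (canonicalDual π g Λ l) (π l g)).re ∧
      (inner ℂ (canonicalDual π g Λ l) (π l g)).re ≤ 1)
    (h : |(∑ᶠ l ∈ Λ ∩ x • K n, (inner ℂ (canonicalDual π g Λ l) (π l g)).re) -
        D * μ.real (K n)| ≤ ε * μ.real (K n)) :
    D / 2 ≤ pointDensity μ Λ (K n) x ∧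
      |frameAverage π g Λ (x • K n) - D / pointDensity μ Λ (K n) x| ≤ 2 / D * ε := by
  obtain ⟨-, -, hS⟩ := frameAverage_mem_Icc hfin h01
  have hm := hK.measureReal_pos n
  rw [frameAverage, pointDensity]
  set S := ∑ᶠ l ∈ Λ ∩ x • K n, (inner ℂ (canonicalDual π g Λ l) (π l g)).re
  set m := μ.real (K n)
  set k := ((Λ ∩ x • K n).ncard : ℝ)
  -- Each summand is at most `1`, so the count dominates the sum, which is at least `(D - ε)m`.
  have h1 : D / 2 * m ≤ k := by
    have h2 := (abs_sub_le_iff.1 h).2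
    have h3 : ε * m ≤ D / 2 * m := by gcongr
    linarith
  have hk : 0 < k := lt_of_lt_of_le (by positivity) h1
  refine ⟨(le_div_iff₀ hm).2 h1, ?_⟩
  have h4 : k⁻¹ * S - D / (k / m) = (S - D * m) / k := by field_simp
  rw [h4, abs_div, abs_of_pos hk, div_le_iff₀ hk]
  have hε : 0 ≤ ε := by
    by_contra hneg
    have : ε * m < 0 := mul_neg_of_neg_of_pos (not_le.1 hneg) hm
    linarith [abs_nonneg (S - D * m)]
  calc |S - D * m| ≤ ε * m := h
    _ = 2 / D * ε * (D / 2 * m) := by field_simp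
    _ ≤ 2 / D * ε * k := by gcongr

end

end CoherentFrame

theorem corollary3p3 {G : Type*} [Group G] [TopologicalSpace G] [IsTopologicalGroup G]
    [T2Space G] [LocallyCompactSpace G] [SecondCountableTopology G]
    [MeasurableSpace G] [BorelSpace G]
    (μ : Measure G) [μ.IsHaarMeasure] [μ.IsMulRightInvariant]
    (Q : Set G) (hQ_compact : IsCompact Q) (hQ_symm : Q⁻¹ = Q) (hQ_nhds : Q ∈ 𝓝 (1 : G))
    {H : Type*} [NormedAddCommGroup H] [InnerProductSpace ℂ H] [CompleteSpace H]
    (π : G → H ≃ₗᵢ[ℂ] H) (hπ : CoherentFrame.IsDiscreteSeries μ π)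
    (g : H) (hg_ne : g ≠ 0) (hg : g ∈ CoherentFrame.B2 μ Q π)
    (Λ : Set G) (hΛ : IsDiscrete Λ) (hframe : CoherentFrame.IsCoherentFrame π g Λ) :
    ∃ Mlow Mup : ℝ, ∀ K : ℕ → Set G, CoherentFrame.IsStrongFolner μ K →
      (∀ᶠ n in atTop, ∀ x : G, (Λ ∩ x • K n).Finite ∧ (Λ ∩ x • K n).Nonempty) ∧
      CoherentFrame.HasLowerFrameMeasure π g Λ K Mlow ∧
      CoherentFrame.HasUpperFrameMeasure π g Λ K Mup := by
  open CoherentFrame in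
  have hproj := hπ.projective
  have hΛc : Λ.Countable := by
    have := hΛ.to_subtype
    exact Set.countable_coe_iff.1 (TopologicalSpace.separableSpace_iff_countable.1 inferInstance)
  have hmeas := hproj.stronglyMeasurable_coeff g g
  obtain ⟨M, -, hMi, -, hM2⟩ := exists_measurable_majorant hQ_compact hQ_symm hmeas hg
  obtain ⟨c, hc0, hc⟩ := exists_integral_norm_coeff_sq_eq hproj hπ.irreducible hg_ne
    (memLp_two_of_majorant hQ_nhds hmeas hMi hM2)
  have hulf := hframe.isUniformlyLocallyFinite hproj hc hc0 hg_ne hΛc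
  obtain ⟨-, -, -, h01⟩ := hframe.canonicalDual_spec
  obtain ⟨Dup, hDup⟩ := exists_upper_density (μ := μ) hulf hΛc
  obtain ⟨Dlow, hDlow⟩ := exists_lower_density (μ := μ) hulf hΛc hQ_compact hQ_symm hQ_nhds
  set D := ‖g‖ ^ 2 / c
  have hD : 0 < D := by
    have := norm_pos_iff.2 hg_ne
    positivity
  -- Taking reciprocals exchanges infimum and supremum.
  refine ⟨D / Dup, D / Dlow, fun K hK => ?_⟩
  have hfin : ∀ (n : ℕ) (x : G), (Λ ∩ x • K n).Finite := fun n x => hulf.finite ((hK.isCompact n).smul x)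
  have hbdd : ∀ n, BddAbove (Set.range (pointDensity μ Λ (K n))) := fun n =>
    hulf.bddAbove (hK.isCompact n)
  have hkey : ∀ ε : ℝ, 0 < ε → ∀ᶠ n in atTop, ∀ x : G, D / 2 ≤ pointDensity μ Λ (K n) x ∧
      |frameAverage π g Λ (x • K n) - D / pointDensity μ Λ (K n) x| ≤ ε := by
    intro ε hε
    have hδ : 0 < min (D / 2) (D / 2 * ε) := by positivity
    filter_upwards [eventually_abs_finsum_sub_le hQ_compact hQ_symm hQ_nhds hproj hc hc0 hg hΛc
      hulf hframe hK hδ] with n hn x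
    obtain ⟨h1, h2⟩ := abs_frameAverage_sub_le hK hD (min_le_left _ _) (hfin n x) h01 (hn x)
    refine ⟨h1, h2.trans ?_⟩
    calc 2 / D * min (D / 2) (D / 2 * ε) ≤ 2 / D * (D / 2 * ε) := by
          gcongr
          exact min_le_right _ _
      _ = ε := by field_simp
  have hlower : ∀ᶠ n in atTop, ∀ x : G, D / 2 ≤ pointDensity μ Λ (K n) x := by
    filter_upwards [hkey 1 one_pos] with n hn x using (hn x).1
  -- The limiting densities stay positive, so the quotients converge.
  have hDlow0 : D / 2 ≤ Dlow := by
    refine ge_of_tendsto (hDlow K hK) ?_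
    filter_upwards [hlower] with n hn using le_ciInf hn
  have hDup0 : D / 2 ≤ Dup := by
    refine ge_of_tendsto (hDup K hK) ?_
    filter_upwards [hlower] with n hn using (hn 1).trans (le_ciSup (hbdd n) 1)
  have hbb : ∀ n, BddBelow (Set.range fun x : G => D / pointDensity μ Λ (K n) x) := fun n =>
    ⟨0, by rintro _ ⟨x, rfl⟩; exact div_nonneg hD.le (pointDensity_nonneg (K n) x)⟩
  have hlim : ∀ {u v : ℕ → ℝ} {a : ℝ}, Tendsto v atTop (𝓝 a) →
      (∀ ε : ℝ, 0 < ε → ∀ᶠ n in atTop, |u n - v n| ≤ ε) → Tendsto u atTop (𝓝 a) := by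
    intro u v a hv huv
    have h0 : Tendsto (fun n => u n - v n) atTop (𝓝 0) := by
      refine Metric.tendsto_nhds.2 fun ε hε => ?_
      filter_upwards [huv (ε / 2) (half_pos hε)] with n hn
      rw [Real.dist_eq, sub_zero]
      linarith
    simpa using h0.add hv
  refine ⟨?_, ?_, ?_⟩
  · filter_upwards [hlower] with n hn x
    refine ⟨hfin n x, Set.nonempty_iff_ne_empty.2 fun he => ?_⟩
    have h1 := hn x
    rw [pointDensity, he] at h1
    simp only [Set.ncard_empty, Nat.cast_zero, zero_div] at h1
    linarith
  · refine hlim (Tendsto.div tendsto_const_nhds (hDup K hK) (by linarith)) fun ε hε => ?_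
    filter_upwards [hkey ε hε] with n hn
    rw [Pi.div_apply, ← iInf_const_div (half_pos hD) hD (fun x => (hn x).1) (hbdd n)]
    exact abs_iInf_sub_iInf_le
      ⟨0, by rintro _ ⟨x, rfl⟩; exact (frameAverage_mem_Icc (hfin n x) h01).1⟩ (hbb n)
      fun x => (hn x).2
  · refine hlim (Tendsto.div tendsto_const_nhds (hDlow K hK) (by linarith)) fun ε hε => ?_
    filter_upwards [hkey ε hε] with n hn
    rw [Pi.div_apply, ← iSup_const_div (half_pos hD) hD fun x => (hn x).1]
    refine abs_iSup_sub_iSup_le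
      ⟨1, by rintro _ ⟨x, rfl⟩; exact (frameAverage_mem_Icc (hfin n x) h01).2.1⟩
      ⟨D / (D / 2), ?_⟩ fun x => (hn x).2
    rintro _ ⟨x, rfl⟩
    exact div_le_div_of_nonneg_left hD.le (half_pos hD) (hn x).1
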